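/- Let $(\Xi_n)_{n\ge 1}$ be a sequence of random real $2\times 2$ matrices whose entries are all mutually independent and uniformly distributed on $[-1,1]$. For every $\varepsilon\in(0,1)$ there exists a constant $c_2(\varepsilon)>0$, depending only on $\varepsilon$, such that the following holds for every sequence $(A_n)_{n\ge1}$ of real $2\times2$ matrices of operator norm at most $1$ (with respect to the Euclidean norm). Put $A_\varepsilon^{(n)}=(A_n+\varepsilon\,\Xi_n)(A_{n-1}+\varepsilon\,\Xi_{n-1})\cdots(A_1+\varepsilon\,\Xi_1)$, and let $s_1(M)\ge s_2(M)$ denote the singular values of a $2\times 2$ matrix $M$. Then the random variable $$\liminf_{n\to\infty}\frac1n\log\frac{s_1(A_\varepsilon^{(n)})}{s_2(A_\varepsilon^{(n)})}$$ is almost surely equal to a (finite) constant, and this constant is at least $c_2(\varepsilon)$. Moreover, the constants can be chosen such that $c_2(\varepsilon)>\exp(-1/\varepsilon^{35})$ for all sufficiently small $\varepsilon>0$. -/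

import Mathlib

open MeasureTheory ProbabilityTheory Filter Topology

noncomputable section

/-- The operator norm `‖M‖ = sup_{‖x‖₂ = 1} ‖M x‖₂` of a real square matrix
(with respect to the Euclidean norm). -/
def matOpNorm {d : ℕ} (M : Matrix (Fin d) (Fin d) ℝ) : ℝ :=
  ‖Matrix.toEuclideanCLM (n := Fin d) (𝕜 := ℝ) M‖

/-- The `j`-th singular value `s_j(M)` for `1 ≤ j ≤ d`, in decreasing order
(Mathlib numbers singular values from `0`). -/
def singVal {d : ℕ} (M : Matrix (Fin d) (Fin d) ℝ) (j : ℕ) : ℝ :=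
  (Matrix.toEuclideanCLM (n := Fin d) (𝕜 := ℝ) M).toLinearMap.singularValues (j - 1)

/-- `(Ξ n)` is a sequence of random `d × d` matrices all of whose entries (over all `n, i, j`)
are mutually independent and uniformly distributed on `[-1, 1]`. -/
structure IsUniformNoise {Ω : Type*} [MeasurableSpace Ω] (P : Measure Ω) {d : ℕ}
    (Ξ : ℕ → Ω → Matrix (Fin d) (Fin d) ℝ) : Prop where
  measurable_entry : ∀ n i j, Measurable fun ω => Ξ n ω i j
  uniform_entry : ∀ n i j, pdf.IsUniform (fun ω => Ξ n ω i j) (Set.Icc (-1 : ℝ) 1) P volume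
  indep_entries : iIndepFun (fun (p : ℕ × Fin d × Fin d) ω => Ξ p.1 ω p.2.1 p.2.2) P

/-- The perturbed product `A_ε^{(n)} = (A_n + ε Ξ_n) ⋯ (A_1 + ε Ξ_1)`; the sequences are indexed
from `0` here, so the term called `A_k` in the product is `A (k - 1)`. -/
def perturbedProd {d : ℕ} (A Ξ : ℕ → Matrix (Fin d) (Fin d) ℝ) (ε : ℝ) :
    ℕ → Matrix (Fin d) (Fin d) ℝ
  | 0 => 1
  | n + 1 => (A n + ε • Ξ n) * perturbedProd A Ξ ε n

/-- The lower growth rate `liminf_{n → ∞} (1/n) log (s_1(A_ε^{(n)}) / s_2(A_ε^{(n)}))`, taken in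
the extended reals, where no boundedness is needed for the `liminf` to make sense. -/
def gapRate {d : ℕ} (A Ξ : ℕ → Matrix (Fin d) (Fin d) ℝ) (ε : ℝ) : EReal :=
  liminf (fun n : ℕ => (((1 / (n : ℝ)) *
    Real.log (singVal (perturbedProd A Ξ ε n) 1 / singVal (perturbedProd A Ξ ε n) 2) : ℝ) : EReal))
    atTop

end

/-!
The growth of the gap is bounded below by a contraction argument in `L²` of the projective line.

A matrix `g` acts isometrically on half-densities, that is, on functions `F` of the plane with
`F (c v) = |c|⁻¹ F v`, by `(g · F) v = |det g|^{1/2} F (g v)`; the norm is computed in the chart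
`t ↦ [t : 1]`. The average of these isometries over `g = A + ε Ξ` contracts norms, uniformly in `A`
(`projNormSq_boxAvg_le`). Indeed `2 ‖E g · F‖² + E ‖g · F - g' · F‖² = 2 ‖F‖²` with `g'` an
independent copy of `g`, so a weak contraction would mean that `g · F` hardly depends on `g`. For a
shear `U` near the identity the laws of `U g` and `g` are comparable, because Lebesgue measure on
matrices is invariant under `U`, and `‖U g · F - g · F‖ = ‖U · F - F‖`; hence `F` would be nearly
invariant under small shears in both coordinate directions
(`shiftDist_le_lintegral_actDist`). In the chart such a shear is a translation of the line, and a
function that is nearly invariant under translations puts less than half of its mass on `(-1, 1)`,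
since many translates of this interval are disjoint (`five_mul_lintegral_Ioo_le`). Applied in the
two charts, which together cover the projective line, this is a contradiction. All the losses are
polynomial, and the contraction factor of squared norms is `1 - κ` with `κ = ε² / 10⁸`.

Iterating over the independent factors and inserting the rotation-invariant half-density
`v ↦ 1 / ‖v‖`, one gets `E[(s₂ / s₁)^{1/2}] ≤ (1 - κ)^{n / 2}` for the product of `n` factors, because
`|det M|^{1/2} / ‖M v‖ ≥ (s₂ / s₁)^{1/2} / ‖v‖`. By Borel–Cantelli the growth rate is almost surely
at least `κ / 2`, which is far larger than `exp (-1 / ε ^ 35)`. In the same way the bound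
`E |det (A + ε Ξ)|^{-1/2} ≤ C` shows that the growth rate is almost surely finite and that the
products are almost surely invertible. Invertibility makes the growth rate insensitive to the
first `m` factors for each `m`, so that Kolmogorov's zero-one law makes it constant
(`IsUniformNoise.exists_gapRate_ae_eq_const`).
-/

open scoped ENNReal

/-! ### A distance on the extended nonnegative reals -/

/-- The distance `|a - b|` of two extended nonnegative reals, written with truncated subtraction;
`absDiff ∞ ∞ = 0`. -/
noncomputable def absDiff (a b : ℝ≥0∞) : ℝ≥0∞ := (a - b) + (b - a)

theorem absDiff_comm (a b : ℝ≥0∞) : absDiff a b = absDiff b a := add_comm _ _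

/-- The parallelogram-type identity behind all variance computations; it holds for infinite
values too. -/
theorem two_mul_add_absDiff_sq (a b : ℝ≥0∞) :
    2 * (a * b) + absDiff a b ^ 2 = a ^ 2 + b ^ 2 := by
  wlog h : a ≤ b generalizing a b
  · rw [absDiff_comm, mul_comm a b, add_comm (a ^ 2)]
    exact this b a (le_of_not_ge h)
  rw [absDiff, tsub_eq_zero_of_le h, zero_add]
  rcases eq_or_ne a ∞ with rfl | ha
  · obtain rfl : b = ∞ := top_le_iff.1 h
    simp
  · obtain ⟨e, rfl⟩ := exists_add_of_le h
    rw [ENNReal.add_sub_cancel_left ha]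
    ring

theorem two_mul_mul_le_sq_add_sq (a b : ℝ≥0∞) : 2 * (a * b) ≤ a ^ 2 + b ^ 2 :=
  le_self_add.trans (two_mul_add_absDiff_sq a b).le

theorem sq_le_of_le_add {a b c : ℝ≥0∞} (h : a ≤ b + c) : a ^ 2 ≤ 2 * b ^ 2 + 2 * c ^ 2 :=
  calc a ^ 2 ≤ (b + c) ^ 2 := pow_le_pow_left' h 2
    _ = b ^ 2 + c ^ 2 + 2 * (b * c) := by ring
    _ ≤ b ^ 2 + c ^ 2 + (b ^ 2 + c ^ 2) := by gcongr; exact two_mul_mul_le_sq_add_sq b c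
    _ = _ := by ring

theorem absDiff_triangle (a b c : ℝ≥0∞) : absDiff a c ≤ absDiff a b + absDiff b c := by
  unfold absDiff
  calc a - c + (c - a) ≤ (a - b + (b - c)) + (c - b + (b - a)) :=
        add_le_add tsub_le_tsub_add_tsub tsub_le_tsub_add_tsub
    _ = _ := by ring

theorem le_add_absDiff (a b : ℝ≥0∞) : a ≤ b + absDiff a b :=
  le_add_tsub.trans (add_le_add_right le_self_add b)

theorem mul_absDiff {k : ℝ≥0∞} (hk : k ≠ ∞) (a b : ℝ≥0∞) :
    absDiff (k * a) (k * b) = k * absDiff a b := by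
  unfold absDiff
  rw [mul_add, ENNReal.mul_sub fun _ _ => hk, ENNReal.mul_sub fun _ _ => hk]

theorem Measurable.absDiff {α : Type*} [MeasurableSpace α] {f g : α → ℝ≥0∞} (hf : Measurable f)
    (hg : Measurable g) : Measurable fun x => absDiff (f x) (g x) :=
  (hf.sub hg).add (hg.sub hf)

/-- `2 (E g)² + E |g - g'|² = 2 E g²`, where `g'` is an independent copy of `g`. -/
theorem two_mul_sq_lintegral_add {α : Type*} [MeasurableSpace α] {ν : Measure α}
    [IsProbabilityMeasure ν] {g : α → ℝ≥0∞} (hg : Measurable g) :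
    2 * (∫⁻ p, g p ∂ν) ^ 2 + ∫⁻ p, ∫⁻ q, absDiff (g p) (g q) ^ 2 ∂ν ∂ν
      = 2 * ∫⁻ p, g p ^ 2 ∂ν := by
  have h1 : 2 * (∫⁻ p, g p ∂ν) ^ 2 = ∫⁻ p, ∫⁻ q, 2 * (g p * g q) ∂ν ∂ν := by
    have : ∀ p, ∫⁻ q, 2 * (g p * g q) ∂ν = 2 * (∫⁻ q, g q ∂ν) * g p := fun p => by
      rw [lintegral_const_mul _ (hg.const_mul _), lintegral_const_mul _ hg]; ring
    simp_rw [this]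
    rw [lintegral_const_mul _ hg]
    ring
  have hm : Measurable fun z : α × α => absDiff (g z.1) (g z.2) ^ 2 :=
    ((hg.comp measurable_fst).absDiff (hg.comp measurable_snd)).pow_const 2
  rw [h1, ← lintegral_add_right _ hm.lintegral_prod_right']
  have h2 : ∀ p, ∫⁻ q, 2 * (g p * g q) ∂ν + ∫⁻ q, absDiff (g p) (g q) ^ 2 ∂ν
      = g p ^ 2 + ∫⁻ q, g q ^ 2 ∂ν := fun p => by
    rw [← lintegral_add_left ((hg.const_mul _).const_mul _)]
    simp_rw [two_mul_add_absDiff_sq]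
    rw [lintegral_add_left measurable_const, lintegral_const, measure_univ, mul_one]
  simp_rw [h2]
  rw [lintegral_add_right _ measurable_const, lintegral_const, measure_univ, mul_one, two_mul]

/-- The identity `two_mul_sq_lintegral_add` integrated over a parameter. -/
theorem two_mul_lintegral_sq_lintegral_add {α β : Type*} [MeasurableSpace α] [MeasurableSpace β]
    {ν : Measure α} [IsProbabilityMeasure ν] {m : Measure β} [SFinite m] {g : α → β → ℝ≥0∞}
    (hg : Measurable (Function.uncurry g)) :
    2 * ∫⁻ t, (∫⁻ p, g p t ∂ν) ^ 2 ∂m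
        + ∫⁻ p, ∫⁻ q, ∫⁻ t, absDiff (g p t) (g q t) ^ 2 ∂m ∂ν ∂ν
      = 2 * ∫⁻ p, ∫⁻ t, g p t ^ 2 ∂m ∂ν := by
  have hg' : Measurable fun z : β × α => g z.2 z.1 := hg.comp measurable_swap
  have hT : Measurable fun t => (∫⁻ p, g p t ∂ν) ^ 2 := hg'.lintegral_prod_right'.pow_const 2
  have hD3 : Measurable fun z : (α × β) × α => absDiff (g z.1.1 z.1.2) (g z.2 z.1.2) ^ 2 :=
    ((hg.comp (measurable_fst.fst.prodMk measurable_fst.snd)).absDiff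
      (hg.comp (measurable_snd.prodMk measurable_fst.snd))).pow_const 2
  have hsw : ∫⁻ p, ∫⁻ q, ∫⁻ t, absDiff (g p t) (g q t) ^ 2 ∂m ∂ν ∂ν
      = ∫⁻ t, ∫⁻ p, ∫⁻ q, absDiff (g p t) (g q t) ^ 2 ∂ν ∂ν ∂m := by
    rw [lintegral_lintegral_swap (f := fun t p => ∫⁻ q, absDiff (g p t) (g q t) ^ 2 ∂ν)]
    · refine lintegral_congr fun p => ?_
      rw [lintegral_lintegral_swap (f := fun t q => absDiff (g p t) (g q t) ^ 2)]
      exact (hD3.comp ((measurable_const.prodMk measurable_fst).prodMk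
        measurable_snd)).aemeasurable
    · exact (hD3.lintegral_prod_right'.comp measurable_swap).aemeasurable
  rw [hsw, ← lintegral_const_mul _ hT, ← lintegral_add_left (hT.const_mul _)]
  have h1 : ∀ t, 2 * (∫⁻ p, g p t ∂ν) ^ 2 + ∫⁻ p, ∫⁻ q, absDiff (g p t) (g q t) ^ 2 ∂ν ∂ν
      = 2 * ∫⁻ p, g p t ^ 2 ∂ν := fun t =>
    two_mul_sq_lintegral_add (hg.comp (measurable_id.prodMk measurable_const))
  simp_rw [h1]
  rw [lintegral_const_mul _ (hg'.pow_const 2).lintegral_prod_right',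
    lintegral_lintegral_swap (f := fun t p => g p t ^ 2) (hg'.pow_const 2).aemeasurable]

/-! ### Translations of the line -/

/-- The squared `L²` distance between a function on the line and its translate by `s`. -/
noncomputable def shiftDist (φ : ℝ → ℝ≥0∞) (s : ℝ) : ℝ≥0∞ := ∫⁻ t, absDiff (φ (t + s)) (φ t) ^ 2

theorem shiftDist_two_mul_le {φ : ℝ → ℝ≥0∞} (hφ : Measurable φ) (s : ℝ) :
    shiftDist φ (2 * s) ≤ 4 * shiftDist φ s := by
  have hm : Measurable fun t => absDiff (φ (t + s)) (φ t) ^ 2 :=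
    ((hφ.comp (measurable_id.add_const s)).absDiff hφ).pow_const 2
  have hm' : Measurable fun t => absDiff (φ (t + s + s)) (φ (t + s)) ^ 2 :=
    hm.comp (measurable_id.add_const s)
  calc shiftDist φ (2 * s)
      ≤ ∫⁻ t, (2 * absDiff (φ (t + s + s)) (φ (t + s)) ^ 2
          + 2 * absDiff (φ (t + s)) (φ t) ^ 2) := by
        refine lintegral_mono fun t => ?_
        rw [two_mul, ← add_assoc]
        exact sq_le_of_le_add (absDiff_triangle _ _ _)
    _ = 2 * (∫⁻ t, absDiff (φ (t + s + s)) (φ (t + s)) ^ 2)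
          + 2 * ∫⁻ t, absDiff (φ (t + s)) (φ t) ^ 2 := by
        rw [lintegral_add_right _ (hm.const_mul _), lintegral_const_mul _ hm,
          lintegral_const_mul _ hm']
    _ = 4 * shiftDist φ s := by
        have h := lintegral_add_right_eq_self (μ := volume)
          (fun t => absDiff (φ (t + s)) (φ t) ^ 2) s
        beta_reduce at h
        rw [h, shiftDist]
        ring

theorem shiftDist_two_pow_mul_le {φ : ℝ → ℝ≥0∞} (hφ : Measurable φ) (s : ℝ) (j : ℕ) :
    shiftDist φ (2 ^ j * s) ≤ 4 ^ j * shiftDist φ s := by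
  induction j with
  | zero => simp
  | succ j ih =>
    calc shiftDist φ (2 ^ (j + 1) * s) = shiftDist φ (2 * (2 ^ j * s)) := by ring_nf
      _ ≤ 4 * shiftDist φ (2 ^ j * s) := shiftDist_two_mul_le hφ _
      _ ≤ 4 * (4 ^ j * shiftDist φ s) := by gcongr
      _ = _ := by ring

/-- A function that hardly moves under the translations by `2, 4, …, 32` cannot be concentrated on
`(-1, 1)`, since these translations carry `(-1, 1)` to disjoint intervals. -/
theorem five_mul_lintegral_Ioo_le {φ : ℝ → ℝ≥0∞} (hφ : Measurable φ) :
    5 * ∫⁻ t in Set.Ioo (-1) 1, φ t ^ 2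
      ≤ 2 * (∫⁻ t, φ t ^ 2) + 2 * ∑ j ∈ Finset.range 5, shiftDist φ (2 ^ (j + 1)) := by
  have hone : ∀ w : ℝ, ∫⁻ t in Set.Ioo (-1) 1, φ t ^ 2
      ≤ 2 * (∫⁻ t in Set.Ioo (w - 1) (w + 1), φ t ^ 2) + 2 * shiftDist φ w := fun w => by
    have hm : Measurable fun t => absDiff (φ (t + w)) (φ t) ^ 2 :=
      ((hφ.comp (measurable_id.add_const w)).absDiff hφ).pow_const 2
    have hw : Measurable fun t => φ (t + w) ^ 2 :=
      (hφ.comp (measurable_id.add_const w)).pow_const 2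
    have htr : ∫⁻ t in Set.Ioo (-1) 1, φ (t + w) ^ 2
        = ∫⁻ t in Set.Ioo (w - 1) (w + 1), φ t ^ 2 := by
      rw [← (measurePreserving_add_right volume w).setLIntegral_comp_preimage measurableSet_Ioo
        (hφ.pow_const 2)]
      congr 2
      ext t
      simp only [Set.mem_preimage, Set.mem_Ioo]
      constructor <;> rintro ⟨h1, h2⟩ <;> constructor <;> linarith
    calc ∫⁻ t in Set.Ioo (-1) 1, φ t ^ 2
        ≤ ∫⁻ t in Set.Ioo (-1) 1, (2 * φ (t + w) ^ 2 + 2 * absDiff (φ (t + w)) (φ t) ^ 2) := by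
          refine lintegral_mono fun t => ?_
          rw [absDiff_comm]
          exact sq_le_of_le_add (le_add_absDiff _ _)
      _ = 2 * (∫⁻ t in Set.Ioo (-1) 1, φ (t + w) ^ 2)
            + 2 * ∫⁻ t in Set.Ioo (-1) 1, absDiff (φ (t + w)) (φ t) ^ 2 := by
          rw [lintegral_add_right _ (hm.const_mul _), lintegral_const_mul _ hm,
            lintegral_const_mul _ hw]
      _ ≤ _ := by
          rw [htr]
          gcongr
          exact setLIntegral_le_lintegral _ _
  have hdisj : Set.PairwiseDisjoint (↑(Finset.range 5))
      fun j : ℕ => Set.Ioo ((2 : ℝ) ^ (j + 1) - 1) (2 ^ (j + 1) + 1) := by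
    have key : ∀ i j : ℕ, i < j → Disjoint (Set.Ioo ((2 : ℝ) ^ (i + 1) - 1) (2 ^ (i + 1) + 1))
        (Set.Ioo ((2 : ℝ) ^ (j + 1) - 1) (2 ^ (j + 1) + 1)) := fun i j hij => by
      rw [Set.disjoint_left]
      rintro t ⟨-, h1⟩ ⟨h2, -⟩
      have h3 : (2 : ℝ) ^ (i + 1 + 1) ≤ 2 ^ (j + 1) :=
        pow_le_pow_right₀ one_le_two (by omega)
      have h4 : (1 : ℝ) ≤ 2 ^ i := one_le_pow₀ one_le_two
      rw [pow_succ, pow_succ] at h3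
      rw [pow_succ] at h1
      linarith
    intro i _ j _ hij
    rcases lt_or_gt_of_ne hij with h | h
    · exact key i j h
    · exact (key j i h).symm
  calc 5 * ∫⁻ t in Set.Ioo (-1) 1, φ t ^ 2
      = ∑ j ∈ Finset.range 5, ∫⁻ t in Set.Ioo (-1) 1, φ t ^ 2 := by simp
    _ ≤ ∑ j ∈ Finset.range 5,
          (2 * (∫⁻ t in Set.Ioo ((2 : ℝ) ^ (j + 1) - 1) (2 ^ (j + 1) + 1), φ t ^ 2)
            + 2 * shiftDist φ (2 ^ (j + 1))) := Finset.sum_le_sum fun j _ => hone _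
    _ = 2 * (∫⁻ t in ⋃ j ∈ Finset.range 5,
            Set.Ioo ((2 : ℝ) ^ (j + 1) - 1) (2 ^ (j + 1) + 1), φ t ^ 2)
          + 2 * ∑ j ∈ Finset.range 5, shiftDist φ (2 ^ (j + 1)) := by
        rw [lintegral_biUnion_finset hdisj (fun _ _ => measurableSet_Ioo), Finset.sum_add_distrib,
          Finset.mul_sum, Finset.mul_sum]
    _ ≤ _ := by
        gcongr
        exact Measure.restrict_le_self

/-- Quantitative form of `five_mul_lintegral_Ioo_le` in terms of one small translation. -/
theorem five_mul_lintegral_Ioo_le_shiftDist {φ : ℝ → ℝ≥0∞} (hφ : Measurable φ) (m : ℕ) :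
    5 * ∫⁻ t in Set.Ioo (-1) 1, φ t ^ 2
      ≤ 2 * (∫⁻ t, φ t ^ 2) + 2728 * 4 ^ m * shiftDist φ ((1 / 2) ^ m) := by
  refine (five_mul_lintegral_Ioo_le hφ).trans ?_
  have hj : ∀ j : ℕ, shiftDist φ (2 ^ (j + 1))
      ≤ 4 ^ (j + 1) * 4 ^ m * shiftDist φ ((1 / 2) ^ m) := fun j => by
    have h := shiftDist_two_pow_mul_le hφ ((1 / 2) ^ m) (j + 1 + m)
    have h2 : (2 : ℝ) ^ (j + 1 + m) * (1 / 2) ^ m = 2 ^ (j + 1) := by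
      rw [pow_add, mul_assoc, ← mul_pow]
      norm_num
    rwa [h2, pow_add (4 : ℝ≥0∞)] at h
  have hsum : ∑ j ∈ Finset.range 5, (4 : ℝ≥0∞) ^ (j + 1) = 1364 := by
    simp only [Finset.sum_range_succ, Finset.sum_range_zero]
    norm_num
  calc 2 * (∫⁻ t, φ t ^ 2) + 2 * ∑ j ∈ Finset.range 5, shiftDist φ (2 ^ (j + 1))
      ≤ 2 * (∫⁻ t, φ t ^ 2)
        + 2 * ∑ j ∈ Finset.range 5, 4 ^ (j + 1) * 4 ^ m * shiftDist φ ((1 / 2) ^ m) := by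
        gcongr with j _
        exact hj j
    _ = 2 * (∫⁻ t, φ t ^ 2) + 2728 * 4 ^ m * shiftDist φ ((1 / 2) ^ m) := by
        rw [← Finset.sum_mul, ← Finset.sum_mul, hsum]
        ring

/-! ### The action of `2 × 2` matrices on homogeneous functions -/

/-- The determinant of the `2 × 2` matrix with rows `q.1` and `q.2`. -/
def rowDet (q : (ℝ × ℝ) × (ℝ × ℝ)) : ℝ := q.1.1 * q.2.2 - q.1.2 * q.2.1

/-- The `2 × 2` matrix with rows `q.1` and `q.2`, applied to the vector `v`. -/
def rowApply (q : (ℝ × ℝ) × (ℝ × ℝ)) (v : ℝ × ℝ) : ℝ × ℝ :=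
  (q.1.1 * v.1 + q.1.2 * v.2, q.2.1 * v.1 + q.2.2 * v.2)

/-- The weight `|det q|^{1/2}`. -/
noncomputable def sqrtDet (q : (ℝ × ℝ) × (ℝ × ℝ)) : ℝ≥0∞ := ENNReal.ofReal √|rowDet q|

/-- The matrix `q` acts on functions of the plane by `(q · F) v = |det q|^{1/2} F (q v)`. On
functions that are homogeneous of degree `-1` (in absolute value), that is, on half-densities of
the projective line, this action is isometric for `projNormSq`. -/
noncomputable def halfAct (q : (ℝ × ℝ) × (ℝ × ℝ)) (F : ℝ × ℝ → ℝ≥0∞) (v : ℝ × ℝ) : ℝ≥0∞ :=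
  sqrtDet q * F (rowApply q v)

/-- `F` is homogeneous of degree `-k` in absolute value: `F (c v) = |c|^{-k} F v`. -/
def NegHomogeneous (k : ℕ) (F : ℝ × ℝ → ℝ≥0∞) : Prop :=
  ∀ c : ℝ, c ≠ 0 → ∀ v, F (c • v) = (ENNReal.ofReal |c|)⁻¹ ^ k * F v

/-- The squared `L²` norm of a half-density on the projective line, computed in the affine chart
`t ↦ [t : 1]`. -/
noncomputable def projNormSq (F : ℝ × ℝ → ℝ≥0∞) : ℝ≥0∞ := ∫⁻ t : ℝ, F (t, 1) ^ 2

@[fun_prop]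
theorem measurable_rowDet : Measurable rowDet := by unfold rowDet; fun_prop

@[fun_prop]
theorem measurable_sqrtDet : Measurable sqrtDet := by unfold sqrtDet; fun_prop

theorem Measurable.halfAct {α : Type*} [MeasurableSpace α] {F : ℝ × ℝ → ℝ≥0∞}
    (hF : Measurable F) {f : α → (ℝ × ℝ) × (ℝ × ℝ)} {g : α → ℝ × ℝ} (hf : Measurable f)
    (hg : Measurable g) : Measurable fun x => halfAct (f x) F (g x) := by
  have h : Measurable fun x => rowApply (f x) (g x) := by
    unfold rowApply
    fun_prop
  exact (measurable_sqrtDet.comp hf).mul (hF.comp h)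

theorem sqrtDet_ne_top (q : (ℝ × ℝ) × (ℝ × ℝ)) : sqrtDet q ≠ ∞ := ENNReal.ofReal_ne_top

theorem sqrtDet_sq (q : (ℝ × ℝ) × (ℝ × ℝ)) : sqrtDet q ^ 2 = ENNReal.ofReal |rowDet q| := by
  rw [sqrtDet, ← ENNReal.ofReal_pow (Real.sqrt_nonneg _), Real.sq_sqrt (abs_nonneg _)]

theorem rowApply_smul (q : (ℝ × ℝ) × (ℝ × ℝ)) (c : ℝ) (v : ℝ × ℝ) :
    rowApply q (c • v) = c • rowApply q v := by
  ext <;> simp [rowApply] <;> ring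

theorem NegHomogeneous.halfAct {k : ℕ} {F : ℝ × ℝ → ℝ≥0∞} (hF : NegHomogeneous k F)
    (q : (ℝ × ℝ) × (ℝ × ℝ)) : NegHomogeneous k (halfAct q F) := fun c hc v => by
  rw [_root_.halfAct, _root_.halfAct, rowApply_smul, hF c hc]
  ring

theorem NegHomogeneous.sq {F : ℝ × ℝ → ℝ≥0∞} (hF : NegHomogeneous 1 F) :
    NegHomogeneous 2 fun v => F v ^ 2 := fun c hc v => by
  simp only
  rw [hF c hc]
  ring

/-- The Möbius change of variables: densities on the projective line, that is, functions
homogeneous of degree `-2`, have an integral that does not depend on the affine chart. -/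
theorem lintegral_density_rowApply {H : ℝ × ℝ → ℝ≥0∞} (hH : NegHomogeneous 2 H)
    {q : (ℝ × ℝ) × (ℝ × ℝ)} (hq : rowDet q ≠ 0) :
    ∫⁻ t : ℝ, ENNReal.ofReal |rowDet q| * H (rowApply q (t, 1)) = ∫⁻ t : ℝ, H (t, 1) := by
  obtain ⟨⟨a, b⟩, c, d⟩ := q
  simp only [rowDet] at hq
  simp only [rowDet, rowApply, mul_one]
  have hnull : ∀ p r : ℝ, (p = 0 → r ≠ 0) → ∀ᵐ t : ℝ, p * t + r ≠ 0 := fun p r hpr => by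
    have hsub : {t : ℝ | ¬ p * t + r ≠ 0}.Subsingleton := by
      intro x hx y hy
      simp only [ne_eq, not_not, Set.mem_ofPred_eq] at hx hy
      have hp : p ≠ 0 := by
        rintro rfl
        exact hpr rfl (by simpa using hx)
      exact mul_left_cancel₀ hp (by linarith)
    exact hsub.measure_zero _
  have hcd : c = 0 → d ≠ 0 := by rintro rfl rfl; simp at hq
  have hca : c = 0 → -a ≠ 0 := by rintro rfl h; simp [neg_eq_zero.1 h] at hq
  set S : Set ℝ := {t | c * t + d ≠ 0} with hS
  have hSm : MeasurableSet S := by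
    refine MeasurableSet.compl (measurableSet_eq_fun ?_ measurable_const)
    fun_prop
  have himg : (fun t => (a * t + b) / (c * t + d)) '' S = {y | c * y + -a ≠ 0} := by
    ext y
    constructor
    · rintro ⟨t, ht, rfl⟩
      simp only [hS, Set.mem_ofPred_eq] at ht ⊢
      intro h
      apply hq
      field_simp at h
      linarith
    · intro hy
      simp only [Set.mem_ofPred_eq] at hy
      have e : c * ((b - d * y) / (c * y + -a)) + d = -(a * d - b * c) / (c * y + -a) := by
        field_simp
        ring
      have hne : c * ((b - d * y) / (c * y + -a)) + d ≠ 0 := by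
        rw [e]
        exact div_ne_zero (neg_ne_zero.2 hq) hy
      refine ⟨(b - d * y) / (c * y + -a), hne, ?_⟩
      simp only
      rw [div_eq_iff hne, e, ← mul_div_assoc, ← mul_div_assoc, div_add' _ _ _ hy,
        div_left_inj' hy]
      ring
  have hderiv : ∀ t ∈ S, HasDerivWithinAt (fun t => (a * t + b) / (c * t + d))
      ((a * d - b * c) / (c * t + d) ^ 2) S t := fun t ht => by
    have h1 : HasDerivAt (fun t => a * t + b) a t := by
      simpa using ((hasDerivAt_id t).const_mul a).add_const b
    have h2 : HasDerivAt (fun t => c * t + d) c t := by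
      simpa using ((hasDerivAt_id t).const_mul c).add_const d
    refine ((h1.div h2 ht).congr_deriv ?_).hasDerivWithinAt
    ring
  have hinj : Set.InjOn (fun t => (a * t + b) / (c * t + d)) S := fun x hx y hy hxy => by
    simp only [hS, Set.mem_ofPred_eq] at hx hy
    rw [div_eq_div_iff hx hy] at hxy
    exact mul_left_cancel₀ hq (by linear_combination hxy)
  have hcv := lintegral_image_eq_lintegral_abs_deriv_mul hSm hderiv hinj fun y => H (y, 1)
  rw [himg, setLIntegral_congr (t := Set.univ)
    (eventuallyEq_univ.2 (hnull c (-a) hca)), Measure.restrict_univ] at hcv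
  have hSu : (volume : Measure ℝ).restrict S = volume := by
    rw [Measure.restrict_congr_set (eventuallyEq_univ.2 (hnull c d hcd)), Measure.restrict_univ]
  rw [hcv]
  nth_rewrite 1 [← hSu]
  refine setLIntegral_congr_fun hSm fun t ht => ?_
  simp only [hS, Set.mem_ofPred_eq] at ht
  have hv : (a * t + b, c * t + d) = (c * t + d) • ((a * t + b) / (c * t + d), (1 : ℝ)) := by
    refine Prod.ext ?_ (mul_one _).symm
    rw [Prod.smul_fst, smul_eq_mul, ← mul_div_assoc, mul_div_cancel_left₀ _ ht]
  rw [hv, hH _ ht, ← mul_assoc, abs_div, ENNReal.ofReal_div_of_pos (by positivity), abs_pow,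
    ENNReal.ofReal_pow (abs_nonneg _), ENNReal.inv_pow.symm, ← div_eq_mul_inv]

theorem projNormSq_halfAct {F : ℝ × ℝ → ℝ≥0∞} (hF : NegHomogeneous 1 F)
    {q : (ℝ × ℝ) × (ℝ × ℝ)} (hq : rowDet q ≠ 0) :
    projNormSq (halfAct q F) = projNormSq F := by
  simp_rw [projNormSq, halfAct, mul_pow, sqrtDet_sq]
  exact lintegral_density_rowApply hF.sq hq

/-- The matrix `q` with `s` times its second row added to its first row. -/
def rowShear (s : ℝ) (q : (ℝ × ℝ) × (ℝ × ℝ)) : (ℝ × ℝ) × (ℝ × ℝ) := (q.1 + s • q.2, q.2)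

/-- The isometries attached to `rowShear s q` and `q` differ on `F` exactly as much as `F` and its
translate by `s`, whatever `q` is. -/
theorem lintegral_absDiff_halfAct_rowShear {F : ℝ × ℝ → ℝ≥0∞} (hF : NegHomogeneous 1 F) (s : ℝ)
    {q : (ℝ × ℝ) × (ℝ × ℝ)} (hq : rowDet q ≠ 0) :
    ∫⁻ t : ℝ, absDiff (halfAct (rowShear s q) F (t, 1)) (halfAct q F (t, 1)) ^ 2
      = shiftDist (fun t => F (t, 1)) s := by
  have hH : NegHomogeneous 2 fun v => absDiff (F (v.1 + s * v.2, v.2)) (F v) ^ 2 :=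
    fun c hc v => by
      have h1 : ((c • v).1 + s * (c • v).2, (c • v).2) = c • (v.1 + s * v.2, v.2) := by
        ext <;> simp
        ring
      have h2 : (ENNReal.ofReal |c|)⁻¹ ^ 1 ≠ ∞ := by simpa using hc
      simp only
      rw [h1, hF c hc, hF c hc, mul_absDiff h2]
      ring
  have hdet : sqrtDet (rowShear s q) = sqrtDet q := by
    unfold sqrtDet
    congr 3
    simp [rowDet, rowShear]
    ring
  have h := lintegral_density_rowApply hH hq
  simp only [mul_one] at h
  rw [shiftDist, ← h]
  refine lintegral_congr fun t => ?_
  have happ : rowApply (rowShear s q) (t, 1)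
      = ((rowApply q (t, 1)).1 + s * (rowApply q (t, 1)).2, (rowApply q (t, 1)).2) := by
    ext <;> simp [rowApply, rowShear]
    ring
  rw [halfAct, halfAct, hdet, mul_absDiff (sqrtDet_ne_top q), mul_pow, sqrtDet_sq, happ]

/-- The chart at infinity covers the complement of `[-1, 1]`. -/
theorem projNormSq_le_add_swap {F : ℝ × ℝ → ℝ≥0∞} (hF : NegHomogeneous 1 F) (hm : Measurable F) :
    projNormSq F ≤ (∫⁻ t in Set.Ioo (-1 : ℝ) 1, F (t, 1) ^ 2)
      + ∫⁻ t in Set.Ioo (-1 : ℝ) 1, F (1, t) ^ 2 := by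
  -- `K` is the cone of the directions in which the first coordinate dominates
  set K : Set (ℝ × ℝ) := {v | |v.2| < |v.1|} with hK
  have hKm : MeasurableSet K := measurableSet_lt measurable_snd.abs measurable_fst.abs
  have hH : NegHomogeneous 2 (K.indicator fun v => F v ^ 2) := fun c hc v => by
    have hiff : c • v ∈ K ↔ v ∈ K := by
      simp [hK, abs_mul, abs_pos.2 hc]
    by_cases hv : v ∈ K
    · rw [Set.indicator_of_mem hv, Set.indicator_of_mem (hiff.2 hv)]
      exact hF.sq c hc v
    · rw [Set.indicator_of_notMem hv, Set.indicator_of_notMem (mt hiff.1 hv), mul_zero]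
  have hswap := lintegral_density_rowApply hH (q := ((0, 1), (1, 0))) (by simp [rowDet])
  simp only [rowDet, rowApply, zero_mul, one_mul, mul_one, zero_add, add_zero, zero_sub, abs_neg,
    abs_one, ENNReal.ofReal_one] at hswap
  have hK1 : ∫⁻ t : ℝ, K.indicator (fun v => F v ^ 2) (1, t)
      = ∫⁻ t in Set.Ioo (-1 : ℝ) 1, F (1, t) ^ 2 := by
    rw [← lintegral_indicator measurableSet_Ioo]
    refine lintegral_congr fun t => ?_
    simp only [Set.indicator_apply, hK, Set.mem_ofPred_eq, abs_one, abs_lt, Set.mem_Ioo]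
  have hKF : Measurable fun t : ℝ => K.indicator (fun v => F v ^ 2) (t, 1) :=
    ((hm.pow_const 2).indicator hKm).comp (measurable_id.prodMk measurable_const)
  rw [← hK1, hswap, ← lintegral_indicator measurableSet_Ioo, projNormSq,
    ← lintegral_add_right _ hKF]
  refine lintegral_mono_ae ?_
  have h1 : ∀ᵐ t : ℝ, t ≠ 1 := Measure.ae_ne volume 1
  have h2 : ∀ᵐ t : ℝ, t ≠ -1 := Measure.ae_ne volume (-1)
  filter_upwards [h1, h2] with t ht1 ht2
  rcases lt_trichotomy |t| 1 with h | h | h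
  · rw [Set.indicator_of_mem (show t ∈ Set.Ioo (-1 : ℝ) 1 from abs_lt.1 h)]
    exact le_self_add
  · rcases eq_or_eq_neg_of_abs_eq h with h | h
    · exact absurd h ht1
    · exact absurd h ht2
  · have : ((t, 1) : ℝ × ℝ) ∈ K := by simpa [hK] using h
    simp only [Set.indicator_of_mem this]
    exact le_add_self

/-! ### Uniform measures on boxes of matrices -/

/-- The cube of the matrices whose entries are within `r` of those of `A`. -/
def rowBox (A : (ℝ × ℝ) × (ℝ × ℝ)) (r : ℝ) : Set ((ℝ × ℝ) × (ℝ × ℝ)) :=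
  (Set.Icc (A.1.1 - r) (A.1.1 + r) ×ˢ Set.Icc (A.1.2 - r) (A.1.2 + r)) ×ˢ
    (Set.Icc (A.2.1 - r) (A.2.1 + r) ×ˢ Set.Icc (A.2.2 - r) (A.2.2 + r))

/-- The uniform probability measure on `rowBox A r`. -/
noncomputable def boxMeasure (A : (ℝ × ℝ) × (ℝ × ℝ)) (r : ℝ) : Measure ((ℝ × ℝ) × (ℝ × ℝ)) :=
  (ENNReal.ofReal (2 * r) ^ 4)⁻¹ • volume.restrict (rowBox A r)

theorem measurableSet_rowBox (A : (ℝ × ℝ) × (ℝ × ℝ)) (r : ℝ) : MeasurableSet (rowBox A r) :=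
  (measurableSet_Icc.prod measurableSet_Icc).prod (measurableSet_Icc.prod measurableSet_Icc)

theorem restrict_rowBox (A : (ℝ × ℝ) × (ℝ × ℝ)) (r : ℝ) :
    volume.restrict (rowBox A r)
      = ((volume.restrict (Set.Icc (A.1.1 - r) (A.1.1 + r))).prod
          (volume.restrict (Set.Icc (A.1.2 - r) (A.1.2 + r)))).prod
        ((volume.restrict (Set.Icc (A.2.1 - r) (A.2.1 + r))).prod
          (volume.restrict (Set.Icc (A.2.2 - r) (A.2.2 + r)))) := by
  rw [Measure.prod_restrict, Measure.prod_restrict, Measure.prod_restrict]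
  rfl

theorem volume_rowBox (A : (ℝ × ℝ) × (ℝ × ℝ)) (r : ℝ) :
    volume (rowBox A r) = ENNReal.ofReal (2 * r) ^ 4 := by
  have h : ∀ a : ℝ, volume (Set.Icc (a - r) (a + r)) = ENNReal.ofReal (2 * r) := fun a => by
    rw [Real.volume_Icc]
    congr 1
    ring
  rw [rowBox, Measure.volume_eq_prod, Measure.prod_prod, Measure.volume_eq_prod,
    Measure.prod_prod, Measure.prod_prod, h, h, h, h]
  ring

theorem isProbabilityMeasure_boxMeasure (A : (ℝ × ℝ) × (ℝ × ℝ)) {r : ℝ} (hr : 0 < r) :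
    IsProbabilityMeasure (boxMeasure A r) := by
  constructor
  rw [boxMeasure, Measure.smul_apply, Measure.restrict_apply_univ, volume_rowBox, smul_eq_mul]
  refine ENNReal.inv_mul_cancel ?_ (by finiteness)
  have : 0 < ENNReal.ofReal (2 * r) := by positivity
  positivity

theorem lintegral_rowBox_eq (A : (ℝ × ℝ) × (ℝ × ℝ)) {r : ℝ} (hr : 0 < r)
    (Φ : (ℝ × ℝ) × (ℝ × ℝ) → ℝ≥0∞) :
    ∫⁻ q in rowBox A r, Φ q = ENNReal.ofReal (2 * r) ^ 4 * ∫⁻ q, Φ q ∂boxMeasure A r := by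
  have : 0 < ENNReal.ofReal (2 * r) := by positivity
  rw [boxMeasure, lintegral_smul_measure, smul_eq_mul, ← mul_assoc,
    ENNReal.mul_inv_cancel (by positivity) (by finiteness), one_mul]

/-! ### The determinant of a random matrix is rarely small -/

/-- The integral of `|x|^{-1/2}` over `[-1, 1]`. -/
noncomputable def invSqrtMass : ℝ≥0∞ := ∫⁻ x in Set.Icc (-1 : ℝ) 1, (ENNReal.ofReal √|x|)⁻¹

theorem invSqrtMass_lt_top : invSqrtMass < ∞ := by
  have hm : Measurable fun x : ℝ => (ENNReal.ofReal √|x|)⁻¹ := by fun_prop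
  have hpos : ∫⁻ x in Set.Ioc (0 : ℝ) 1, (ENNReal.ofReal √|x|)⁻¹ < ∞ := by
    have h : IntegrableOn (fun x : ℝ => x ^ (-(1 / 2) : ℝ)) (Set.Ioc 0 1) :=
      (intervalIntegrable_iff_integrableOn_Ioc_of_le zero_le_one).1
        (intervalIntegral.intervalIntegrable_rpow' (by norm_num))
    have h2 := h.lintegral_lt_top
    refine lt_of_eq_of_lt (setLIntegral_congr_fun measurableSet_Ioc fun x hx => ?_) h2
    rw [abs_of_pos hx.1, Real.rpow_neg hx.1.le, ← Real.sqrt_eq_rpow,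
      ENNReal.ofReal_inv_of_pos (Real.sqrt_pos.2 hx.1)]
  have hneg : ∫⁻ x in Set.Ico (-1 : ℝ) 0, (ENNReal.ofReal √|x|)⁻¹
      = ∫⁻ x in Set.Ioc (0 : ℝ) 1, (ENNReal.ofReal √|x|)⁻¹ := by
    rw [← (Measure.measurePreserving_neg (volume : Measure ℝ)).setLIntegral_comp_preimage
      measurableSet_Ioc hm]
    simp
  have hsub : Set.Icc (-1 : ℝ) 1 ⊆ Set.Ico (-1 : ℝ) 0 ∪ {0} ∪ Set.Ioc (0 : ℝ) 1 := fun x hx => by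
    rcases lt_trichotomy x 0 with h | h | h
    · exact Or.inl (Or.inl ⟨hx.1, h⟩)
    · exact Or.inl (Or.inr h)
    · exact Or.inr ⟨h, hx.2⟩
  calc invSqrtMass ≤ ∫⁻ x in Set.Ico (-1 : ℝ) 0 ∪ {0} ∪ Set.Ioc (0 : ℝ) 1,
        (ENNReal.ofReal √|x|)⁻¹ := lintegral_mono_set hsub
    _ ≤ _ := lintegral_union_le _ _ _
    _ ≤ _ := add_le_add_left (lintegral_union_le _ _ _) _
    _ < ∞ := by
      rw [hneg]
      simp [ENNReal.add_lt_top, hpos]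

theorem lintegral_inv_sqrt_sub_le (a r z : ℝ) :
    ∫⁻ x in Set.Icc (a - r) (a + r), (ENNReal.ofReal √|x - z|)⁻¹
      ≤ invSqrtMass + ENNReal.ofReal (2 * r) := by
  have hm : Measurable fun x : ℝ => (ENNReal.ofReal √|x|)⁻¹ := by fun_prop
  set J : Set ℝ := Set.Icc (z - 1) (z + 1) with hJ
  have hmass : ∫⁻ x in J, (ENNReal.ofReal √|x - z|)⁻¹ = invSqrtMass := by
    rw [invSqrtMass, ← (measurePreserving_sub_right volume z).setLIntegral_comp_preimage
      measurableSet_Icc hm]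
    congr 2
    ext x
    simp only [hJ, Set.mem_preimage, Set.mem_Icc]
    constructor <;> rintro ⟨h1, h2⟩ <;> constructor <;> linarith
  calc ∫⁻ x in Set.Icc (a - r) (a + r), (ENNReal.ofReal √|x - z|)⁻¹
      ≤ ∫⁻ x in Set.Icc (a - r) (a + r),
          (J.indicator (fun x => (ENNReal.ofReal √|x - z|)⁻¹) x + 1) := by
        refine lintegral_mono fun x => ?_
        by_cases hx : x ∈ J
        · rw [Set.indicator_of_mem hx]
          exact le_self_add
        · rw [Set.indicator_of_notMem hx, zero_add, ENNReal.inv_le_one]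
          have h1 : 1 ≤ |x - z| := by
            by_contra! h
            rw [abs_lt] at h
            exact hx ⟨by linarith, by linarith⟩
          rw [← ENNReal.ofReal_one]
          exact ENNReal.ofReal_le_ofReal (Real.one_le_sqrt.2 h1)
    _ = (∫⁻ x in Set.Icc (a - r) (a + r), J.indicator (fun x => (ENNReal.ofReal √|x - z|)⁻¹) x)
          + ENNReal.ofReal (2 * r) := by
        rw [lintegral_add_right _ measurable_const, lintegral_const, one_mul,
          Measure.restrict_apply_univ, Real.volume_Icc]
        congr 2
        ring
    _ ≤ (∫⁻ x, J.indicator (fun x => (ENNReal.ofReal √|x - z|)⁻¹) x)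
          + ENNReal.ofReal (2 * r) := by
        gcongr
        exact Measure.restrict_le_self
    _ = _ := by rw [lintegral_indicator measurableSet_Icc, hmass]

/-- The negative moment of order `1/2` of the determinant is bounded uniformly over all centres
of the box. -/
theorem lintegral_rowBox_inv_sqrtDet_le (A : (ℝ × ℝ) × (ℝ × ℝ)) {r : ℝ} (hr : 0 < r) :
    ∫⁻ q in rowBox A r, (sqrtDet q)⁻¹
      ≤ (invSqrtMass + ENNReal.ofReal (2 * r)) ^ 2 * ENNReal.ofReal (2 * r) ^ 2 := by
  set K := invSqrtMass + ENNReal.ofReal (2 * r) with hK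
  have hr' : 0 < ENNReal.ofReal (2 * r) := by positivity
  have hvol : ∀ a : ℝ, volume (Set.Icc (a - r) (a + r)) = ENNReal.ofReal (2 * r) := fun a => by
    rw [Real.volume_Icc]
    congr 1
    ring
  have hm : Measurable fun q => (sqrtDet q)⁻¹ := measurable_sqrtDet.inv
  -- the integral over the last entry, the other three being fixed
  have hin : ∀ a b c : ℝ, ∫⁻ d in Set.Icc (A.2.2 - r) (A.2.2 + r), (sqrtDet ((a, b), (c, d)))⁻¹
      ≤ (ENNReal.ofReal √|a|)⁻¹ * K := fun a b c => by
    rcases eq_or_ne a 0 with rfl | ha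
    · have : K ≠ 0 := (lt_of_lt_of_le hr' le_add_self).ne'
      simp [ENNReal.top_mul this]
    · have h : ∀ d, (sqrtDet ((a, b), (c, d)))⁻¹
          = (ENNReal.ofReal √|a|)⁻¹ * (ENNReal.ofReal √|d - b * c / a|)⁻¹ := fun d => by
        rw [← ENNReal.mul_inv (Or.inr ENNReal.ofReal_ne_top) (Or.inl ENNReal.ofReal_ne_top),
          ← ENNReal.ofReal_mul (Real.sqrt_nonneg _), ← Real.sqrt_mul (abs_nonneg _), ← abs_mul,
          mul_sub, mul_div_cancel₀ _ ha]
        rfl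
      simp_rw [h]
      rw [lintegral_const_mul _ (by fun_prop)]
      gcongr
      exact lintegral_inv_sqrt_sub_le _ _ _
  rw [restrict_rowBox, lintegral_prod _ hm.aemeasurable]
  have h2 : ∀ p : ℝ × ℝ, ∫⁻ y, (sqrtDet (p, y))⁻¹
      ∂((volume.restrict (Set.Icc (A.2.1 - r) (A.2.1 + r))).prod
        (volume.restrict (Set.Icc (A.2.2 - r) (A.2.2 + r))))
      ≤ (ENNReal.ofReal √|p.1|)⁻¹ * (K * ENNReal.ofReal (2 * r)) := fun p => by
    rw [lintegral_prod _ (by fun_prop)]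
    calc _ ≤ ∫⁻ c in Set.Icc (A.2.1 - r) (A.2.1 + r), (ENNReal.ofReal √|p.1|)⁻¹ * K :=
          lintegral_mono fun c => hin p.1 p.2 c
      _ = _ := by
        rw [lintegral_const, Measure.restrict_apply_univ, hvol]
        ring
  refine (lintegral_mono h2).trans ?_
  rw [lintegral_mul_const _ (by fun_prop), lintegral_prod _ (by fun_prop)]
  simp only [lintegral_const, Measure.restrict_apply_univ, hvol]
  rw [lintegral_mul_const _ (by fun_prop)]
  have h3 := lintegral_inv_sqrt_sub_le A.1.1 r 0
  simp only [sub_zero] at h3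
  calc _ ≤ K * ENNReal.ofReal (2 * r) * (K * ENNReal.ofReal (2 * r)) := by gcongr
    _ = _ := by ring

theorem ae_rowBox_rowDet_ne_zero (A : (ℝ × ℝ) × (ℝ × ℝ)) {r : ℝ} (hr : 0 < r) :
    ∀ᵐ q ∂volume.restrict (rowBox A r), rowDet q ≠ 0 := by
  have hlt : ∫⁻ q in rowBox A r, (sqrtDet q)⁻¹ < ∞ :=
    (lintegral_rowBox_inv_sqrtDet_le A hr).trans_lt
      (by have := invSqrtMass_lt_top.ne; finiteness)
  filter_upwards [ae_lt_top measurable_sqrtDet.inv hlt.ne] with q hq h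
  simp [sqrtDet, h] at hq

/-! ### The contraction estimate -/

theorem measurePreserving_rowShear (s : ℝ) : MeasurePreserving (rowShear s) volume volume := by
  have h : MeasurePreserving (fun p : (ℝ × ℝ) × (ℝ × ℝ) => (p.1, p.2 + s • p.1))
      ((volume : Measure (ℝ × ℝ)).prod volume) ((volume : Measure (ℝ × ℝ)).prod volume) := by
    refine (MeasurePreserving.id volume).skew_product (g := fun x y => y + s • x) ?_ ?_
    · unfold Function.uncurry
      fun_prop
    · refine Eventually.of_forall fun x => ?_
      rw [Measure.volume_eq_prod]
      exact map_add_right_eq_self _ _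
  exact Measure.measurePreserving_swap.comp (h.comp Measure.measurePreserving_swap)

theorem rowShear_mem_rowBox {A : (ℝ × ℝ) × (ℝ × ℝ)} (h1 : |A.2.1| ≤ 1) (h2 : |A.2.2| ≤ 1)
    {ε s : ℝ} (hε1 : ε ≤ 1) (hs0 : 0 ≤ s) (hs : s ≤ ε / 4)
    {q : (ℝ × ℝ) × (ℝ × ℝ)} (hq : q ∈ rowBox A (ε / 2)) : rowShear s q ∈ rowBox A ε := by
  obtain ⟨⟨⟨a1, a2⟩, b1, b2⟩, ⟨c1, c2⟩, d1, d2⟩ := hq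
  rw [abs_le] at h1 h2
  simp only [rowBox, rowShear, Set.mem_prod, Set.mem_Icc, Prod.fst_add, Prod.snd_add, Prod.smul_fst,
    Prod.smul_snd, smul_eq_mul]
  have hc1 : s * q.2.1 ≤ s * 2 := mul_le_mul_of_nonneg_left (by linarith) hs0
  have hc2 : s * (-2) ≤ s * q.2.1 := mul_le_mul_of_nonneg_left (by linarith) hs0
  have hd1 : s * q.2.2 ≤ s * 2 := mul_le_mul_of_nonneg_left (by linarith) hs0
  have hd2 : s * (-2) ≤ s * q.2.2 := mul_le_mul_of_nonneg_left (by linarith) hs0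
  refine ⟨⟨⟨?_, ?_⟩, ?_, ?_⟩, ⟨?_, ?_⟩, ?_, ?_⟩ <;> linarith

/-- The squared `L²` distance between the half-densities `p · F` and `q · F`. -/
noncomputable def actDist (F : ℝ × ℝ → ℝ≥0∞) (p q : (ℝ × ℝ) × (ℝ × ℝ)) : ℝ≥0∞ :=
  ∫⁻ t : ℝ, absDiff (halfAct p F (t, 1)) (halfAct q F (t, 1)) ^ 2

theorem actDist_comm (F : ℝ × ℝ → ℝ≥0∞) (p q : (ℝ × ℝ) × (ℝ × ℝ)) :
    actDist F p q = actDist F q p := by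
  simp_rw [actDist, absDiff_comm (halfAct p F _)]

theorem measurable_actDist {F : ℝ × ℝ → ℝ≥0∞} (hF : Measurable F) :
    Measurable (Function.uncurry (actDist F)) := by
  have h1 : Measurable fun z : (((ℝ × ℝ) × (ℝ × ℝ)) × ((ℝ × ℝ) × (ℝ × ℝ))) × ℝ =>
      halfAct z.1.1 F (z.2, 1) :=
    hF.halfAct (by fun_prop) (by fun_prop)
  have h2 : Measurable fun z : (((ℝ × ℝ) × (ℝ × ℝ)) × ((ℝ × ℝ) × (ℝ × ℝ))) × ℝ =>
      halfAct z.1.2 F (z.2, 1) :=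
    hF.halfAct (by fun_prop) (by fun_prop)
  exact ((h1.absDiff h2).pow_const 2).lintegral_prod_right'

theorem actDist_le {F : ℝ × ℝ → ℝ≥0∞} (hF : Measurable F) (p q r : (ℝ × ℝ) × (ℝ × ℝ)) :
    actDist F p r ≤ 2 * actDist F p q + 2 * actDist F q r := by
  have hm : ∀ p : (ℝ × ℝ) × (ℝ × ℝ), Measurable fun t : ℝ => halfAct p F (t, 1) := fun p =>
    hF.halfAct measurable_const (by fun_prop)
  have hm2 : ∀ p q : (ℝ × ℝ) × (ℝ × ℝ),
      Measurable fun t : ℝ => absDiff (halfAct p F (t, 1)) (halfAct q F (t, 1)) ^ 2 := fun p q =>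
    ((hm p).absDiff (hm q)).pow_const 2
  rw [actDist, actDist, actDist, ← lintegral_const_mul _ (hm2 p q),
    ← lintegral_const_mul _ (hm2 q r), ← lintegral_add_right _ ((hm2 q r).const_mul 2)]
  exact lintegral_mono fun t => sq_le_of_le_add (absDiff_triangle _ _ _)

/-- If the isometries attached to two independent uniform matrices in a box typically agree on
`F`, then `F` is nearly invariant under small translations: the laws of `q` and `rowShear s q`
are comparable. -/
theorem shiftDist_le_lintegral_actDist {F : ℝ × ℝ → ℝ≥0∞} (hF : NegHomogeneous 1 F)
    (hm : Measurable F) {A : (ℝ × ℝ) × (ℝ × ℝ)} (h1 : |A.2.1| ≤ 1) (h2 : |A.2.2| ≤ 1)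
    {ε s : ℝ} (hε : 0 < ε) (hε1 : ε ≤ 1) (hs0 : 0 ≤ s) (hs : s ≤ ε / 4) :
    shiftDist (fun t => F (t, 1)) s
      ≤ 64 * ∫⁻ p, ∫⁻ q, actDist F p q ∂boxMeasure A ε ∂boxMeasure A ε := by
  have hprob := isProbabilityMeasure_boxMeasure A hε
  have hD := measurable_actDist hm
  set V : ℝ≥0∞ := ENNReal.ofReal (2 * ε) ^ 4 with hV
  have hV0 : V ≠ 0 := by
    have : 0 < ENNReal.ofReal (2 * ε) := by positivity
    positivity
  have hVt : V ≠ ∞ := by finiteness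
  have hhalf : 16 * volume (rowBox A (ε / 2)) = V := by
    rw [volume_rowBox, hV, show (2 : ℝ) * ε = 2 * (2 * (ε / 2)) by ring,
      ENNReal.ofReal_mul (q := 2 * (ε / 2)) zero_le_two, ENNReal.ofReal_ofNat]
    ring
  have hstep : ∀ p, shiftDist (fun t => F (t, 1)) s * volume (rowBox A (ε / 2))
      ≤ 4 * (V * ∫⁻ q, actDist F p q ∂boxMeasure A ε) := fun p => by
    have hDp : Measurable (actDist F p) := hD.of_uncurry_left
    have hDs : Measurable fun q => actDist F p (rowShear s q) :=
      hDp.comp (measurePreserving_rowShear s).measurable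
    calc shiftDist (fun t => F (t, 1)) s * volume (rowBox A (ε / 2))
        = ∫⁻ q in rowBox A (ε / 2), actDist F (rowShear s q) q := by
          rw [← Measure.restrict_apply_univ, ← lintegral_const]
          refine lintegral_congr_ae ?_
          filter_upwards [ae_rowBox_rowDet_ne_zero A (half_pos hε)] with q hq
          exact (lintegral_absDiff_halfAct_rowShear hF s hq).symm
      _ ≤ ∫⁻ q in rowBox A (ε / 2), (2 * actDist F p (rowShear s q) + 2 * actDist F p q) := by
          refine lintegral_mono fun q => ?_
          rw [actDist_comm F p (rowShear s q)]
          exact actDist_le hm _ _ _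
      _ = 2 * (∫⁻ q in rowBox A (ε / 2), actDist F p (rowShear s q))
            + 2 * ∫⁻ q in rowBox A (ε / 2), actDist F p q := by
          rw [lintegral_add_right _ (hDp.const_mul 2), lintegral_const_mul _ hDp,
            lintegral_const_mul _ hDs]
      _ ≤ 2 * (∫⁻ q in rowBox A ε, actDist F p q) + 2 * ∫⁻ q in rowBox A ε, actDist F p q := by
          gcongr 2 * ?_ + 2 * ?_
          · calc ∫⁻ q in rowBox A (ε / 2), actDist F p (rowShear s q)
                ≤ ∫⁻ q in rowShear s ⁻¹' rowBox A ε, actDist F p (rowShear s q) :=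
                  lintegral_mono_set fun q hq => rowShear_mem_rowBox h1 h2 hε1 hs0 hs hq
              _ = ∫⁻ q in rowBox A ε, actDist F p q :=
                  (measurePreserving_rowShear s).setLIntegral_comp_preimage
                    (measurableSet_rowBox A ε) hDp
          · refine lintegral_mono_set fun q hq => ?_
            obtain ⟨⟨⟨a1, a2⟩, b1, b2⟩, ⟨c1, c2⟩, d1, d2⟩ := hq
            refine ⟨⟨⟨?_, ?_⟩, ?_, ?_⟩, ⟨?_, ?_⟩, ?_, ?_⟩ <;> linarith
      _ = 4 * (V * ∫⁻ q, actDist F p q ∂boxMeasure A ε) := by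
          rw [lintegral_rowBox_eq A hε]
          ring
  have hDi : Measurable fun p => ∫⁻ q, actDist F p q ∂boxMeasure A ε := hD.lintegral_prod_right'
  have hint := lintegral_mono (μ := boxMeasure A ε) hstep
  rw [lintegral_const, measure_univ, mul_one,
    lintegral_const_mul _ (hDi.const_mul V), lintegral_const_mul _ hDi] at hint
  refine (ENNReal.mul_le_mul_iff_left hV0 hVt).1 ?_
  calc shiftDist (fun t => F (t, 1)) s * V
      = 16 * (shiftDist (fun t => F (t, 1)) s * volume (rowBox A (ε / 2))) := by
        rw [← hhalf]
        ring
    _ ≤ 16 * (4 * (V * ∫⁻ p, ∫⁻ q, actDist F p q ∂boxMeasure A ε ∂boxMeasure A ε)) := by gcongr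
    _ = _ := by ring

theorem measurePreserving_swap_boxMeasure (A : (ℝ × ℝ) × (ℝ × ℝ)) (r : ℝ) :
    MeasurePreserving Prod.swap (boxMeasure A r) (boxMeasure A.swap r) := by
  have h : MeasurePreserving Prod.swap (volume.restrict (rowBox A r))
      (volume.restrict (rowBox A.swap r)) := by
    rw [restrict_rowBox, restrict_rowBox]
    exact Measure.measurePreserving_swap
  exact h.smul_measure _

/-- Exchanging the two rows of `q` is the same as exchanging the two coordinates of `F`. -/
theorem halfAct_swap (q : (ℝ × ℝ) × (ℝ × ℝ)) (F : ℝ × ℝ → ℝ≥0∞) :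
    halfAct q.swap (fun v => F v.swap) = halfAct q F := by
  funext v
  have h : sqrtDet q.swap = sqrtDet q := by
    unfold sqrtDet rowDet
    rw [abs_sub_comm]
    simp only [Prod.fst_swap, Prod.snd_swap]
    congr 4 <;> ring
  rw [halfAct, halfAct, h]
  rfl

theorem lintegral_actDist_swap {F : ℝ × ℝ → ℝ≥0∞} (hm : Measurable F) (A : (ℝ × ℝ) × (ℝ × ℝ))
    {r : ℝ} (hr : 0 < r) :
    ∫⁻ p, ∫⁻ q, actDist (fun v => F v.swap) p q ∂boxMeasure A.swap r ∂boxMeasure A.swap r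
      = ∫⁻ p, ∫⁻ q, actDist F p q ∂boxMeasure A r ∂boxMeasure A r := by
  have := isProbabilityMeasure_boxMeasure A.swap hr
  have hD := measurable_actDist (hm.comp measurable_swap)
  have hsw := measurePreserving_swap_boxMeasure A r
  have hDi : Measurable fun p => ∫⁻ q, actDist (fun v => F v.swap) p q ∂boxMeasure A.swap r :=
    hD.lintegral_prod_right'
  rw [← hsw.lintegral_comp hDi]
  refine lintegral_congr fun p => ?_
  rw [← hsw.lintegral_comp (show Measurable (actDist (fun v => F v.swap) p.swap) from
    hD.of_uncurry_left)]
  refine lintegral_congr fun q => ?_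
  rw [actDist, halfAct_swap, halfAct_swap, actDist]

/-- A half-density cannot be nearly invariant under the shears in both coordinate directions: the
first kind of shear forbids it to concentrate on the directions `|x| < |y|`, the second kind on
the directions `|y| < |x|`. Hence the variance of `q · F` is a definite fraction of its norm. -/
theorem projNormSq_le_lintegral_actDist {F : ℝ × ℝ → ℝ≥0∞} (hF : NegHomogeneous 1 F)
    (hm : Measurable F) (hN : projNormSq F ≠ ∞) {A : (ℝ × ℝ) × (ℝ × ℝ)}
    (h11 : |A.1.1| ≤ 1) (h12 : |A.1.2| ≤ 1) (h21 : |A.2.1| ≤ 1) (h22 : |A.2.2| ≤ 1)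
    {ε : ℝ} (hε : 0 < ε) (hε1 : ε ≤ 1) :
    ENNReal.ofReal (ε ^ 2) * projNormSq F
      ≤ 22347776 * ∫⁻ p, ∫⁻ q, actDist F p q ∂boxMeasure A ε ∂boxMeasure A ε := by
  set Q := ∫⁻ p, ∫⁻ q, actDist F p q ∂boxMeasure A ε ∂boxMeasure A ε with hQ
  set N := projNormSq F with hNdef
  obtain ⟨n, hn1, hn2⟩ := exists_nat_pow_near_of_lt_one (show 0 < ε / 4 by positivity)
    (show ε / 4 ≤ 1 by linarith) (show (0 : ℝ) < 1 / 2 by norm_num) (by norm_num)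
  have hF' : NegHomogeneous 1 fun v => F v.swap := fun c hc v => by
    simp only
    rw [Prod.smul_swap, hF c hc]
  have hm' : Measurable fun v : ℝ × ℝ => F v.swap := hm.comp measurable_swap
  have hN' : projNormSq (fun v => F v.swap) = N := by
    rw [hNdef, ← projNormSq_halfAct hF (q := ((0, 1), (1, 0))) (by simp [rowDet])]
    congr 1
    funext v
    simp [halfAct, sqrtDet, rowDet, rowApply, Prod.swap]
  have e1 := five_mul_lintegral_Ioo_le_shiftDist (φ := fun t => F (t, 1)) (by fun_prop) (n + 1)
  have e2 := five_mul_lintegral_Ioo_le_shiftDist (φ := fun t => F (1, t)) (by fun_prop) (n + 1)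
  have s1 : shiftDist (fun t => F (t, 1)) ((1 / 2) ^ (n + 1)) ≤ 64 * Q :=
    shiftDist_le_lintegral_actDist hF hm h21 h22 hε hε1 (by positivity) hn1.le
  have s2 : shiftDist (fun t => F (1, t)) ((1 / 2) ^ (n + 1)) ≤ 64 * Q := by
    rw [hQ, ← lintegral_actDist_swap hm A hε]
    exact shiftDist_le_lintegral_actDist hF' hm' (A := A.swap) h11 h12 hε hε1 (by positivity)
      hn1.le
  have n2 : ∫⁻ t : ℝ, F (1, t) ^ 2 = N := hN'
  have n1 : ∫⁻ t : ℝ, F (t, 1) ^ 2 = N := rfl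
  rw [n1] at e1
  rw [n2] at e2
  have key : 5 * N ≤ 4 * N + 349184 * 4 ^ (n + 1) * Q := by
    calc 5 * N ≤ 5 * ((∫⁻ t in Set.Ioo (-1 : ℝ) 1, F (t, 1) ^ 2)
          + ∫⁻ t in Set.Ioo (-1 : ℝ) 1, F (1, t) ^ 2) := by
          gcongr
          exact projNormSq_le_add_swap hF hm
      _ ≤ (2 * N + 2728 * 4 ^ (n + 1) * (64 * Q)) + (2 * N + 2728 * 4 ^ (n + 1) * (64 * Q)) := by
          rw [mul_add]
          refine add_le_add (e1.trans ?_) (e2.trans ?_) <;> gcongr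
      _ = _ := by ring
  have key2 : N ≤ 349184 * 4 ^ (n + 1) * Q := by
    have h4 : 4 * N ≠ ∞ := by finiteness
    refine (ENNReal.add_le_add_iff_left h4).1 (le_trans (le_of_eq ?_) key)
    ring
  have key3 : ENNReal.ofReal (ε ^ 2) * 4 ^ (n + 1) ≤ 64 := by
    have h4 : (4 : ℝ≥0∞) ^ (n + 1) = ENNReal.ofReal (4 ^ (n + 1)) := by
      rw [ENNReal.ofReal_pow (by norm_num), ENNReal.ofReal_ofNat]
    rw [h4, ← ENNReal.ofReal_mul (by positivity), ← ENNReal.ofReal_ofNat]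
    refine ENNReal.ofReal_le_ofReal ?_
    have h5 : ε * 2 ^ (n + 1) ≤ 8 := by
      have h6 : (1 / 2 : ℝ) ^ n * 2 ^ n = 1 := by rw [← mul_pow]; norm_num
      have h7 : ε / 4 * 2 ^ n ≤ (1 / 2 : ℝ) ^ n * 2 ^ n := by gcongr
      rw [pow_succ]
      linarith
    calc ε ^ 2 * 4 ^ (n + 1) = (ε * 2 ^ (n + 1)) ^ 2 := by
          rw [mul_pow, ← pow_mul, mul_comm (n + 1), pow_mul]
          norm_num
      _ ≤ 8 ^ 2 := by gcongr
      _ = 64 := by norm_num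
  calc ENNReal.ofReal (ε ^ 2) * N
      ≤ ENNReal.ofReal (ε ^ 2) * (349184 * 4 ^ (n + 1) * Q) := by gcongr
    _ = 349184 * (ENNReal.ofReal (ε ^ 2) * 4 ^ (n + 1)) * Q := by ring
    _ ≤ 349184 * 64 * Q := by gcongr
    _ = _ := by norm_num

/-- The average of the isometric action over the uniform law on a box. -/
noncomputable def boxAvg (A : (ℝ × ℝ) × (ℝ × ℝ)) (r : ℝ) (F : ℝ × ℝ → ℝ≥0∞) (v : ℝ × ℝ) :
    ℝ≥0∞ :=
  ∫⁻ q, halfAct q F v ∂boxMeasure A r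

theorem Measurable.boxAvg {F : ℝ × ℝ → ℝ≥0∞} (hF : Measurable F) (A : (ℝ × ℝ) × (ℝ × ℝ)) {r : ℝ}
    (hr : 0 < r) : Measurable (boxAvg A r F) := by
  have := isProbabilityMeasure_boxMeasure A hr
  have h : Measurable fun z : (ℝ × ℝ) × ((ℝ × ℝ) × (ℝ × ℝ)) => _root_.halfAct z.2 F z.1 :=
    hF.halfAct measurable_snd measurable_fst
  exact h.lintegral_prod_right'

theorem NegHomogeneous.boxAvg {F : ℝ × ℝ → ℝ≥0∞} {k : ℕ} (hF : NegHomogeneous k F)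
    (A : (ℝ × ℝ) × (ℝ × ℝ)) (r : ℝ) : NegHomogeneous k (boxAvg A r F) := fun c hc v => by
  have hc' : (ENNReal.ofReal |c|)⁻¹ ^ k ≠ ∞ := ENNReal.pow_ne_top (by simpa using hc)
  rw [_root_.boxAvg, _root_.boxAvg, ← lintegral_const_mul' _ _ hc']
  exact lintegral_congr fun q => hF.halfAct q c hc v

/-- The averaged action contracts the `L²` norm of half-densities, uniformly over the centre of the
box. -/
theorem projNormSq_boxAvg_le {F : ℝ × ℝ → ℝ≥0∞} (hF : NegHomogeneous 1 F)
    (hm : Measurable F) {A : (ℝ × ℝ) × (ℝ × ℝ)}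
    (h11 : |A.1.1| ≤ 1) (h12 : |A.1.2| ≤ 1) (h21 : |A.2.1| ≤ 1) (h22 : |A.2.2| ≤ 1)
    {ε : ℝ} (hε : 0 < ε) (hε1 : ε ≤ 1) :
    projNormSq (boxAvg A ε F) ≤ ENNReal.ofReal (1 - ε ^ 2 / 10 ^ 8) * projNormSq F := by
  have hpos : 0 < 1 - ε ^ 2 / 10 ^ 8 := by nlinarith
  have hprob := isProbabilityMeasure_boxMeasure A hε
  rcases eq_or_ne (projNormSq F) ∞ with hN | hN
  · rw [hN, ENNReal.mul_top (by simpa using hpos)]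
    exact le_top
  have hgap := projNormSq_le_lintegral_actDist hF hm hN h11 h12 h21 h22 hε hε1
  have hvar := two_mul_lintegral_sq_lintegral_add (ν := boxMeasure A ε) (m := volume)
    (g := fun q t => halfAct q F (t, 1)) (hm.halfAct (by fun_prop) (by fun_prop))
  have hiso : ∫⁻ q, ∫⁻ t : ℝ, halfAct q F (t, 1) ^ 2 ∂volume ∂boxMeasure A ε = projNormSq F := by
    have hae : ∀ᵐ q ∂boxMeasure A ε, rowDet q ≠ 0 :=
      Measure.ae_smul_measure (ae_rowBox_rowDet_ne_zero A hε) _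
    rw [lintegral_congr_ae (g := fun _ => projNormSq F) (by
      filter_upwards [hae] with q hq
      exact projNormSq_halfAct hF hq), lintegral_const, measure_univ, mul_one]
  rw [hiso] at hvar
  change 2 * projNormSq (boxAvg A ε F)
    + ∫⁻ p, ∫⁻ q, actDist F p q ∂boxMeasure A ε ∂boxMeasure A ε = 2 * projNormSq F at hvar
  set Q := ∫⁻ p, ∫⁻ q, actDist F p q ∂boxMeasure A ε ∂boxMeasure A ε
  set T := projNormSq (boxAvg A ε F)
  have h2N : 2 * projNormSq F ≠ ∞ := by finiteness
  have hQ : Q ≠ ∞ := ne_top_of_le_ne_top h2N (hvar ▸ le_add_self)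
  have hT : T ≠ ∞ := by
    intro h
    rw [h] at hvar
    simp [eq_comm, h2N] at hvar
  lift T to NNReal using hT with T'
  lift Q to NNReal using hQ with Q'
  lift projNormSq F to NNReal using hN with N'
  have hvar' : 2 * (T' : ℝ) + Q' = 2 * N' := by exact_mod_cast hvar
  have hgap' : ε ^ 2 * (N' : ℝ) ≤ 22347776 * Q' := by
    have h := ENNReal.toReal_mono (by finiteness) hgap
    simpa [ENNReal.toReal_mul, ENNReal.toReal_ofReal (sq_nonneg ε)] using h
  have hfin : (T' : ℝ) ≤ (1 - ε ^ 2 / 10 ^ 8) * N' := by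
    have : 0 ≤ ε ^ 2 * (N' : ℝ) := by positivity
    nlinarith
  rw [← ENNReal.ofReal_coe_nnreal, ← ENNReal.ofReal_coe_nnreal, ← ENNReal.ofReal_mul hpos.le]
  exact ENNReal.ofReal_le_ofReal hfin

/-! ### Singular values of `2 × 2` matrices -/

theorem matOpNorm_nonneg {d : ℕ} (M : Matrix (Fin d) (Fin d) ℝ) : 0 ≤ matOpNorm M :=
  norm_nonneg _

theorem matOpNorm_mul_le {d : ℕ} (M N : Matrix (Fin d) (Fin d) ℝ) :
    matOpNorm (M * N) ≤ matOpNorm M * matOpNorm N := by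
  unfold matOpNorm
  rw [map_mul]
  exact norm_mul_le _ _

theorem matOpNorm_add_le {d : ℕ} (M N : Matrix (Fin d) (Fin d) ℝ) :
    matOpNorm (M + N) ≤ matOpNorm M + matOpNorm N := by
  unfold matOpNorm
  rw [map_add]
  exact norm_add_le _ _

theorem matOpNorm_one_le {d : ℕ} : matOpNorm (1 : Matrix (Fin d) (Fin d) ℝ) ≤ 1 := by
  unfold matOpNorm
  rw [map_one]
  exact ContinuousLinearMap.norm_id_le

theorem continuous_matOpNorm {d : ℕ} :
    Continuous (matOpNorm : Matrix (Fin d) (Fin d) ℝ → ℝ) := by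
  unfold matOpNorm
  exact continuous_norm.comp (LinearMap.continuous_of_finiteDimensional
    (Matrix.toEuclideanCLM (n := Fin d) (𝕜 := ℝ)).toAlgEquiv.toLinearMap)

theorem toEuclideanCLM_apply_apply {d : ℕ} (M : Matrix (Fin d) (Fin d) ℝ)
    (x : EuclideanSpace ℝ (Fin d)) (i : Fin d) :
    Matrix.toEuclideanCLM (n := Fin d) (𝕜 := ℝ) M x i = ∑ j, M i j * x j := by
  rfl

theorem abs_apply_le_matOpNorm {d : ℕ} (M : Matrix (Fin d) (Fin d) ℝ) (i j : Fin d) :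
    |M i j| ≤ matOpNorm M := by
  have h1 := (Matrix.toEuclideanCLM (n := Fin d) (𝕜 := ℝ) M).le_opNorm
    (EuclideanSpace.single j (1 : ℝ))
  have h2 := PiLp.norm_apply_le
    (Matrix.toEuclideanCLM (n := Fin d) (𝕜 := ℝ) M (EuclideanSpace.single j (1 : ℝ))) i
  rw [toEuclideanCLM_apply_apply] at h2
  simp at h1 h2
  exact h2.trans h1

/-- The largest singular value is the operator norm: expand in an orthonormal eigenbasis of
`T* T`. -/
theorem singVal_one (M : Matrix (Fin 2) (Fin 2) ℝ) : singVal M 1 = matOpNorm M := by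
  unfold singVal matOpNorm
  set T := Matrix.toEuclideanCLM (n := Fin 2) (𝕜 := ℝ) M with hT
  have hn : Module.finrank ℝ (EuclideanSpace ℝ (Fin 2)) = 2 := by simp
  have hsym := T.toLinearMap.isSymmetric_adjoint_comp_self
  set b := hsym.eigenvectorBasis hn with hb
  set s := T.toLinearMap.singularValues with hs
  have hs0 : 0 ≤ s 0 := T.toLinearMap.singularValues_nonneg 0
  have hexp : ∀ x, ‖T x‖ ^ 2 = ∑ i : Fin 2, s i ^ 2 * (inner ℝ (b i) x) ^ 2 := fun x => by
    have h1 : ‖T x‖ ^ 2 = inner ℝ ((T.toLinearMap.adjoint ∘ₗ T.toLinearMap) x) x := by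
      rw [LinearMap.comp_apply, LinearMap.adjoint_inner_left, ← real_inner_self_eq_norm_sq]
      rfl
    rw [h1, ← b.sum_inner_mul_inner]
    refine Finset.sum_congr rfl fun i _ => ?_
    rw [hsym, hb, hsym.apply_eigenvectorBasis, hs, T.toLinearMap.sq_singularValues_fin hn,
      inner_smul_right, real_inner_comm x]
    simp only [RCLike.ofReal_real_eq_id, id]
    ring
  refine le_antisymm ?_ ?_
  · have h0 : ‖T (b 0)‖ ^ 2 = s 0 ^ 2 := by
      rw [hexp, Fin.sum_univ_two, b.inner_eq_one, b.inner_eq_zero (by decide)]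
      simp
    have h2 := T.le_opNorm (b 0)
    rw [b.norm_eq_one, mul_one, (sq_eq_sq₀ (norm_nonneg _) hs0).1 h0] at h2
    exact h2
  · refine T.opNorm_le_bound hs0 fun x => ?_
    refine le_of_sq_le_sq ?_ (mul_nonneg hs0 (norm_nonneg _))
    rw [hexp, mul_pow, ← b.sum_sq_inner_right, Finset.mul_sum]
    refine Finset.sum_le_sum fun i _ => ?_
    have : s i ≤ s 0 := T.toLinearMap.singularValues_antitone (Nat.zero_le _)
    have h3 : 0 ≤ s i := T.toLinearMap.singularValues_nonneg i
    gcongr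

theorem singVal_one_mul_singVal_two (M : Matrix (Fin 2) (Fin 2) ℝ) :
    singVal M 1 * singVal M 2 = |M.det| := by
  have h := (Matrix.toEuclideanCLM (n := Fin 2) (𝕜 := ℝ) M).toLinearMap.normDet_eq_prod_singularValues
  rw [LinearMap.normDet_eq_abs_det] at h
  have hn : Module.finrank ℝ (EuclideanSpace ℝ (Fin 2)) = 2 := by simp
  rw [hn, Finset.prod_range_succ, Finset.prod_range_one] at h
  have hdet : LinearMap.det (Matrix.toEuclideanCLM (n := Fin 2) (𝕜 := ℝ) M).toLinearMap
      = M.det := by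
    exact LinearMap.det_toLin _ M
  rw [hdet] at h
  exact h.symm

/-- The ratio of the singular values. For singular `M` both sides vanish by the conventions of
division. -/
theorem singVal_div_singVal (M : Matrix (Fin 2) (Fin 2) ℝ) :
    singVal M 1 / singVal M 2 = matOpNorm M ^ 2 / |M.det| := by
  rw [← singVal_one_mul_singVal_two, ← singVal_one, sq]
  rcases eq_or_ne (singVal M 1) 0 with h | h
  · simp [h]
  · rw [mul_div_mul_left _ _ h]

theorem abs_det_le_sq_matOpNorm (M : Matrix (Fin 2) (Fin 2) ℝ) : |M.det| ≤ matOpNorm M ^ 2 := by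
  rw [← singVal_one_mul_singVal_two, ← singVal_one, sq]
  exact mul_le_mul_of_nonneg_left
    (LinearMap.singularValues_antitone _ (Nat.zero_le 1)) (LinearMap.singularValues_nonneg _ _)

/-! ### Matrices as pairs of rows -/

/-- A `2 × 2` matrix as the pair of its rows. -/
def rowsOf (M : Matrix (Fin 2) (Fin 2) ℝ) : (ℝ × ℝ) × (ℝ × ℝ) := ((M 0 0, M 0 1), (M 1 0, M 1 1))

theorem rowDet_rowsOf (M : Matrix (Fin 2) (Fin 2) ℝ) : rowDet (rowsOf M) = M.det := by
  rw [Matrix.det_fin_two]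
  rfl

theorem sqrtDet_rowsOf_mul (M N : Matrix (Fin 2) (Fin 2) ℝ) :
    sqrtDet (rowsOf (M * N)) = sqrtDet (rowsOf M) * sqrtDet (rowsOf N) := by
  simp_rw [sqrtDet, rowDet_rowsOf]
  rw [Matrix.det_mul, abs_mul, Real.sqrt_mul (abs_nonneg _), ENNReal.ofReal_mul (Real.sqrt_nonneg _)]

theorem halfAct_rowsOf_mul (M N : Matrix (Fin 2) (Fin 2) ℝ) (F : ℝ × ℝ → ℝ≥0∞) (v : ℝ × ℝ) :
    halfAct (rowsOf (M * N)) F v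
      = sqrtDet (rowsOf N) * halfAct (rowsOf M) F (rowApply (rowsOf N) v) := by
  have h : rowApply (rowsOf (M * N)) v = rowApply (rowsOf M) (rowApply (rowsOf N) v) := by
    simp only [rowApply, rowsOf, Matrix.mul_apply, Fin.sum_univ_two]
    ext <;> simp only <;> ring
  rw [halfAct, halfAct, h, sqrtDet_rowsOf_mul]
  ring

/-- The rotation-invariant half-density `v ↦ 1 / ‖v‖`. -/
noncomputable def invNorm (v : ℝ × ℝ) : ℝ≥0∞ := (ENNReal.ofReal √(v.1 ^ 2 + v.2 ^ 2))⁻¹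

@[fun_prop]
theorem measurable_invNorm : Measurable invNorm := by unfold invNorm; fun_prop

theorem negHomogeneous_invNorm : NegHomogeneous 1 invNorm := fun c hc v => by
  have h : √((c • v).1 ^ 2 + (c • v).2 ^ 2) = |c| * √(v.1 ^ 2 + v.2 ^ 2) := by
    rw [← Real.sqrt_sq_eq_abs, ← Real.sqrt_mul (sq_nonneg c)]
    congr 1
    simp only [Prod.smul_fst, Prod.smul_snd, smul_eq_mul]
    ring
  rw [invNorm, invNorm, h, ENNReal.ofReal_mul (abs_nonneg c),
    ENNReal.mul_inv (Or.inr ENNReal.ofReal_ne_top) (Or.inl ENNReal.ofReal_ne_top), pow_one]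

theorem projNormSq_invNorm_ne_top : projNormSq invNorm ≠ ∞ := by
  have h : ∀ t : ℝ, invNorm (t, 1) ^ 2 = ENNReal.ofReal ((1 + t ^ 2)⁻¹) := fun t => by
    have hp : 0 < 1 + t ^ 2 := by positivity
    rw [invNorm, ENNReal.inv_pow.symm, ← ENNReal.ofReal_pow (Real.sqrt_nonneg _),
      Real.sq_sqrt (by positivity), ENNReal.ofReal_inv_of_pos hp]
    simp only [one_pow, add_comm]
  simp_rw [projNormSq, h]
  exact integrable_inv_one_add_sq.lintegral_lt_top.ne

theorem projNormSq_invNorm_ne_zero : projNormSq invNorm ≠ 0 := by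
  have hm : Measurable fun t : ℝ => invNorm (t, 1) ^ 2 := by fun_prop
  rw [projNormSq, ← pos_iff_ne_zero, lintegral_pos_iff_support hm]
  have : Function.support (fun t : ℝ => invNorm (t, 1) ^ 2) = Set.univ := by
    ext t
    simp [invNorm]
  rw [this]
  simp

/-- `|det M|^{1/2} / ‖M‖ = (s₂ / s₁)^{1/2}` bounds the half-density `M · invNorm` from below. -/
theorem sqrtDet_mul_inv_mul_invNorm_le (M : Matrix (Fin 2) (Fin 2) ℝ) (v : ℝ × ℝ) :
    sqrtDet (rowsOf M) * (ENNReal.ofReal (matOpNorm M))⁻¹ * invNorm v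
      ≤ halfAct (rowsOf M) invNorm v := by
  rw [halfAct, mul_assoc]
  gcongr
  rw [invNorm, invNorm, ← ENNReal.mul_inv (Or.inr ENNReal.ofReal_ne_top)
    (Or.inl ENNReal.ofReal_ne_top), ← ENNReal.ofReal_mul (matOpNorm_nonneg M)]
  refine ENNReal.inv_le_inv.2 (ENNReal.ofReal_le_ofReal ?_)
  have h := (Matrix.toEuclideanCLM (n := Fin 2) (𝕜 := ℝ) M).le_opNorm !₂[v.1, v.2]
  rw [EuclideanSpace.norm_eq, EuclideanSpace.norm_eq, Fin.sum_univ_two, Fin.sum_univ_two,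
    toEuclideanCLM_apply_apply, toEuclideanCLM_apply_apply] at h
  simpa [rowApply, rowsOf, Fin.sum_univ_two, matOpNorm] using h

/-! ### Products of independent random matrices -/

theorem measurable_perturbedProd_apply {Ω : Type*} [MeasurableSpace Ω] {d : ℕ}
    {Ξ : ℕ → Ω → Matrix (Fin d) (Fin d) ℝ} (A : ℕ → Matrix (Fin d) (Fin d) ℝ) (ε : ℝ) (n : ℕ)
    (h : ∀ k < n, ∀ i j, Measurable fun ω => Ξ k ω i j) (i j : Fin d) :
    Measurable fun ω => perturbedProd A (fun k => Ξ k ω) ε n i j := by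
  induction n generalizing i with
  | zero => exact measurable_const
  | succ n ih =>
    have hrec : ∀ i, Measurable fun ω => perturbedProd A (fun k => Ξ k ω) ε n i j :=
      fun i => ih (fun k hk => h k (by omega)) i
    have hΞ := h n (by omega) i
    simp only [perturbedProd, Matrix.mul_apply, Matrix.add_apply, Matrix.smul_apply, smul_eq_mul]
    fun_prop

theorem Measurable.rowsOf {Ω : Type*} [MeasurableSpace Ω] {M : Ω → Matrix (Fin 2) (Fin 2) ℝ}
    (h : ∀ i j, Measurable fun ω => M ω i j) : Measurable fun ω => rowsOf (M ω) :=
  ((h 0 0).prodMk (h 0 1)).prodMk ((h 1 0).prodMk (h 1 1))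

theorem measurable_rowsOf_add_smul {Ω : Type*} [MeasurableSpace Ω]
    {X : Ω → Matrix (Fin 2) (Fin 2) ℝ} (h : ∀ i j, Measurable fun ω => X ω i j)
    (M : Matrix (Fin 2) (Fin 2) ℝ) (ε : ℝ) : Measurable fun ω => rowsOf (M + ε • X ω) :=
  Measurable.rowsOf fun i j => ((h i j).const_mul ε).const_add _

theorem measurable_matOpNorm_comp {Ω : Type*} [MeasurableSpace Ω]
    {M : Ω → Matrix (Fin 2) (Fin 2) ℝ} (h : ∀ i j, Measurable fun ω => M ω i j) :
    Measurable fun ω => matOpNorm (M ω) := by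
  have hc : Continuous fun f : Fin 2 → Fin 2 → ℝ => matOpNorm (Matrix.of f) :=
    continuous_matOpNorm
  exact hc.measurable.comp (measurable_pi_iff.2 fun i => measurable_pi_iff.2 fun j => h i j)

theorem boxMeasure_eq_prod (A : (ℝ × ℝ) × (ℝ × ℝ)) (r : ℝ) :
    boxMeasure A r
      = (((ENNReal.ofReal (2 * r))⁻¹ • volume.restrict (Set.Icc (A.1.1 - r) (A.1.1 + r))).prod
          ((ENNReal.ofReal (2 * r))⁻¹ • volume.restrict (Set.Icc (A.1.2 - r) (A.1.2 + r)))).prod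
        (((ENNReal.ofReal (2 * r))⁻¹ • volume.restrict (Set.Icc (A.2.1 - r) (A.2.1 + r))).prod
          ((ENNReal.ofReal (2 * r))⁻¹ • volume.restrict (Set.Icc (A.2.2 - r) (A.2.2 + r)))) := by
  simp only [Measure.prod_smul_left, Measure.prod_smul_right, smul_smul]
  rw [boxMeasure, restrict_rowBox, ENNReal.inv_pow]
  congr 1
  ring

/-- The σ-algebra generated by the noise entries with index in `S`. -/
abbrev noiseAlgebra {Ω : Type*} (Ξ : ℕ → Ω → Matrix (Fin 2) (Fin 2) ℝ) (S : Set (ℕ × Fin 2 × Fin 2)) :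
    MeasurableSpace Ω :=
  ⨆ p ∈ S, MeasurableSpace.comap (fun ω => Ξ p.1 ω p.2.1 p.2.2) inferInstance

theorem noiseAlgebra_mono {Ω : Type*} {Ξ : ℕ → Ω → Matrix (Fin 2) (Fin 2) ℝ}
    {S T : Set (ℕ × Fin 2 × Fin 2)} (h : S ⊆ T) :
    noiseAlgebra Ξ S ≤ noiseAlgebra Ξ T :=
  biSup_mono h

theorem measurable_noiseAlgebra {Ω : Type*} {Ξ : ℕ → Ω → Matrix (Fin 2) (Fin 2) ℝ}
    {S : Set (ℕ × Fin 2 × Fin 2)} {n : ℕ} {i j : Fin 2}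
    (h : (n, i, j) ∈ S) : Measurable[noiseAlgebra Ξ S] fun ω => Ξ n ω i j := by
  refine measurable_iff_comap_le.2 ?_
  exact le_biSup (fun p : ℕ × Fin 2 × Fin 2 =>
    MeasurableSpace.comap (fun ω => Ξ p.1 ω p.2.1 p.2.2) inferInstance) h

section

variable {Ω : Type*} [MeasurableSpace Ω] {P : Measure Ω}
  {Ξ : ℕ → Ω → Matrix (Fin 2) (Fin 2) ℝ}

/-- An affine image of a uniform variable is uniform. -/
theorem map_const_add_mul_of_isUniform {X : Ω → ℝ} (hX : Measurable X)
    (hu : pdf.IsUniform X (Set.Icc (-1 : ℝ) 1) P volume) (a : ℝ) {ε : ℝ} (hε : 0 < ε) :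
    P.map (fun ω => a + ε * X ω)
      = (ENNReal.ofReal (2 * ε))⁻¹ • volume.restrict (Set.Icc (a - ε) (a + ε)) := by
  have hm : Measurable fun x : ℝ => a + ε * x := by fun_prop
  have hvol : (volume : Measure ℝ).map (fun x : ℝ => a + ε * x)
      = ENNReal.ofReal ε⁻¹ • (volume : Measure ℝ) := by
    change (volume : Measure ℝ).map ((fun x => a + x) ∘ fun x => ε * x) = _
    rw [← Measure.map_map (by fun_prop) (by fun_prop),
      Real.map_volume_mul_left hε.ne', Measure.map_smul, map_add_left_eq_self,
      abs_of_pos (inv_pos.2 hε)]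
  have hpre : (fun x : ℝ => a + ε * x) ⁻¹' Set.Icc (a - ε) (a + ε) = Set.Icc (-1) 1 := by
    ext x
    simp only [Set.mem_preimage, Set.mem_Icc]
    constructor <;> rintro ⟨h1, h2⟩ <;> constructor <;> nlinarith
  have hres : ((volume : Measure ℝ).restrict (Set.Icc (-1) 1)).map (fun x : ℝ => a + ε * x)
      = ENNReal.ofReal ε⁻¹ • volume.restrict (Set.Icc (a - ε) (a + ε)) := by
    rw [← hpre, ← Measure.restrict_map hm measurableSet_Icc, hvol, Measure.restrict_smul]
  rw [show (fun ω => a + ε * X ω) = (fun x => a + ε * x) ∘ X from rfl, ← Measure.map_map hm hX, hu,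
    ProbabilityTheory.cond, Measure.map_smul, hres, smul_smul, Real.volume_Icc,
    ENNReal.ofReal_inv_of_pos hε, ENNReal.ofReal_mul zero_le_two,
    ENNReal.mul_inv (Or.inr ENNReal.ofReal_ne_top) (Or.inl ENNReal.ofReal_ne_top)]
  norm_num

theorem map_rowsOf_noise [IsProbabilityMeasure P] (hΞ : IsUniformNoise P Ξ) (M : Matrix (Fin 2) (Fin 2) ℝ) (n : ℕ)
    {ε : ℝ} (hε : 0 < ε) :
    P.map (fun ω => rowsOf (M + ε • Ξ n ω)) = boxMeasure (rowsOf M) ε := by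
  have hm := hΞ.measurable_entry
  have hmap : ∀ i j, P.map (fun ω => M i j + ε * Ξ n ω i j)
      = (ENNReal.ofReal (2 * ε))⁻¹ • volume.restrict (Set.Icc (M i j - ε) (M i j + ε)) :=
    fun i j => map_const_add_mul_of_isUniform (hm n i j) (hΞ.uniform_entry n i j) _ hε
  have hind : iIndepFun (fun (p : ℕ × Fin 2 × Fin 2) ω =>
      M p.2.1 p.2.2 + ε * Ξ p.1 ω p.2.1 p.2.2) P :=
    hΞ.indep_entries.comp (fun p x => M p.2.1 p.2.2 + ε * x) fun p => by fun_prop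
  have hm' : ∀ p : ℕ × Fin 2 × Fin 2,
      Measurable fun ω => M p.2.1 p.2.2 + ε * Ξ p.1 ω p.2.1 p.2.2 :=
    fun p => ((hm _ _ _).const_mul ε).const_add _
  have h4 := hind.indepFun_prodMk_prodMk hm' (n, 0, 0) (n, 0, 1) (n, 1, 0) (n, 1, 1)
    (by simp) (by simp) (by simp) (by simp)
  have hrow : ∀ i, P.map (fun ω => (M i 0 + ε * Ξ n ω i 0, M i 1 + ε * Ξ n ω i 1))
      = (P.map fun ω => M i 0 + ε * Ξ n ω i 0).prod (P.map fun ω => M i 1 + ε * Ξ n ω i 1) :=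
    fun i => (indepFun_iff_map_prod_eq_prod_map_map (hm' (n, i, 0)).aemeasurable
      (hm' (n, i, 1)).aemeasurable).1 (hind.indepFun (i := (n, i, 0)) (j := (n, i, 1)) (by simp))
  have h := (indepFun_iff_map_prod_eq_prod_map_map
    ((hm' (n, 0, 0)).prodMk (hm' (n, 0, 1))).aemeasurable
    ((hm' (n, 1, 0)).prodMk (hm' (n, 1, 1))).aemeasurable).1 h4
  simp only at h
  rw [hrow, hrow, hmap, hmap, hmap, hmap] at h
  rw [boxMeasure_eq_prod]
  exact h

/-- The factor number `n` is independent of the product of the earlier factors. -/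
theorem indepFun_noise_perturbedProd [IsProbabilityMeasure P] (hΞ : IsUniformNoise P Ξ)
    (A : ℕ → Matrix (Fin 2) (Fin 2) ℝ) (ε : ℝ) (n : ℕ) :
    IndepFun (fun ω => rowsOf (A n + ε • Ξ n ω))
      (fun ω => rowsOf (perturbedProd A (fun k => Ξ k ω) ε n)) P := by
  have hind : Indep (noiseAlgebra Ξ {p | p.1 = n}) (noiseAlgebra Ξ {p | p.1 < n}) P :=
    indep_iSup_of_disjoint (m := fun p : ℕ × Fin 2 × Fin 2 =>
        MeasurableSpace.comap (fun ω => Ξ p.1 ω p.2.1 p.2.2) inferInstance)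
      (fun p => (hΞ.measurable_entry p.1 p.2.1 p.2.2).comap_le)
      hΞ.indep_entries.iIndep (Set.disjoint_left.2 fun p hp hp' => hp'.ne hp)
  rw [IndepFun_iff_Indep]
  refine indep_of_indep_of_le_right (indep_of_indep_of_le_left hind ?_) ?_
  · refine measurable_iff_comap_le.1 ?_
    exact @measurable_rowsOf_add_smul _ (noiseAlgebra Ξ {p | p.1 = n}) _
      (fun i j => measurable_noiseAlgebra rfl) (A n) ε
  · refine measurable_iff_comap_le.1 ?_
    refine @Measurable.rowsOf _ (noiseAlgebra Ξ {p | p.1 < n}) _ fun i j => ?_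
    exact @measurable_perturbedProd_apply _ (noiseAlgebra Ξ {p | p.1 < n}) _ _ A ε n
      (fun k hk i j => measurable_noiseAlgebra hk) i j

theorem IsUniformNoise.measurable_rowsOf_perturbedProd (hΞ : IsUniformNoise P Ξ)
    (A : ℕ → Matrix (Fin 2) (Fin 2) ℝ) (ε : ℝ) (n : ℕ) :
    Measurable fun ω => rowsOf (perturbedProd A (fun k => Ξ k ω) ε n) :=
  Measurable.rowsOf (measurable_perturbedProd_apply A ε n fun k _ => hΞ.measurable_entry k)

theorem lintegral_noise_perturbedProd [IsProbabilityMeasure P] (hΞ : IsUniformNoise P Ξ)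
    (A : ℕ → Matrix (Fin 2) (Fin 2) ℝ) {ε : ℝ} (hε : 0 < ε) (n : ℕ)
    {Φ : ((ℝ × ℝ) × (ℝ × ℝ)) × ((ℝ × ℝ) × (ℝ × ℝ)) → ℝ≥0∞} (hΦ : Measurable Φ) :
    ∫⁻ ω, Φ (rowsOf (A n + ε • Ξ n ω), rowsOf (perturbedProd A (fun k => Ξ k ω) ε n)) ∂P
      = ∫⁻ ω, ∫⁻ q, Φ (q, rowsOf (perturbedProd A (fun k => Ξ k ω) ε n))
          ∂boxMeasure (rowsOf (A n)) ε ∂P := by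
  have hprob := isProbabilityMeasure_boxMeasure (rowsOf (A n)) hε
  have hP := hΞ.measurable_rowsOf_perturbedProd A ε n
  have hM : Measurable fun ω => rowsOf (A n + ε • Ξ n ω) :=
    measurable_rowsOf_add_smul (hΞ.measurable_entry n) (A n) ε
  have hlaw := (indepFun_iff_map_prod_eq_prod_map_map hM.aemeasurable hP.aemeasurable).1
    (indepFun_noise_perturbedProd hΞ A ε n)
  rw [map_rowsOf_noise hΞ (A n) n hε] at hlaw
  have : IsProbabilityMeasure (P.map fun ω => rowsOf (perturbedProd A (fun k => Ξ k ω) ε n)) :=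
    Measure.isProbabilityMeasure_map hP.aemeasurable
  rw [← lintegral_map hΦ (hM.prodMk hP), hlaw, lintegral_prod_symm' _ hΦ,
    lintegral_map hΦ.lintegral_prod_left' hP]

/-- The average `v ↦ E[|det P_n|^{1/2} F (P_n v)]` of a half-density over the random product
`P_n` has exponentially small norm. -/
theorem projNormSq_lintegral_perturbedProd_le [IsProbabilityMeasure P] (hΞ : IsUniformNoise P Ξ)
    {A : ℕ → Matrix (Fin 2) (Fin 2) ℝ} (hA : ∀ n, matOpNorm (A n) ≤ 1) {ε : ℝ} (hε : 0 < ε)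
    (hε1 : ε ≤ 1) (n : ℕ) {F : ℝ × ℝ → ℝ≥0∞} (hF : NegHomogeneous 1 F) (hm : Measurable F) :
    projNormSq (fun v => ∫⁻ ω, halfAct (rowsOf (perturbedProd A (fun k => Ξ k ω) ε n)) F v ∂P)
      ≤ ENNReal.ofReal (1 - ε ^ 2 / 10 ^ 8) ^ n * projNormSq F := by
  induction n generalizing F with
  | zero =>
    refine le_of_eq ?_
    simp [perturbedProd, halfAct, rowsOf, rowApply, sqrtDet, rowDet]
  | succ n ih =>
    have hentry : ∀ i j, |A n i j| ≤ 1 := fun i j => (abs_apply_le_matOpNorm _ i j).trans (hA n)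
    have hstep : ∀ v, ∫⁻ ω, halfAct (rowsOf (perturbedProd A (fun k => Ξ k ω) ε (n + 1))) F v ∂P
        = ∫⁻ ω, halfAct (rowsOf (perturbedProd A (fun k => Ξ k ω) ε n))
            (boxAvg (rowsOf (A n)) ε F) v ∂P := fun v => by
      simp only [perturbedProd, halfAct_rowsOf_mul]
      have happ : Measurable fun z : ((ℝ × ℝ) × (ℝ × ℝ)) × ((ℝ × ℝ) × (ℝ × ℝ)) =>
          rowApply z.2 v := by
        unfold rowApply
        fun_prop
      rw [lintegral_noise_perturbedProd hΞ A hε n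
        (Φ := fun z => sqrtDet z.2 * halfAct z.1 F (rowApply z.2 v))
        ((measurable_sqrtDet.comp measurable_snd).mul (hm.halfAct measurable_fst happ))]
      refine lintegral_congr fun ω => ?_
      rw [lintegral_const_mul' _ _ (sqrtDet_ne_top _)]
      rfl
    simp_rw [hstep]
    refine (ih (hF.boxAvg _ _) (hm.boxAvg _ hε)).trans ?_
    rw [pow_succ (ENNReal.ofReal _) n, mul_assoc]
    gcongr
    exact projNormSq_boxAvg_le hF hm (hentry 0 0) (hentry 0 1) (hentry 1 0) (hentry 1 1) hε hε1

/-- Exponential decay of `E[(s₂ / s₁)^{1/2}]` for the random products. -/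
theorem sq_lintegral_sqrtDet_div_matOpNorm_le [IsProbabilityMeasure P] (hΞ : IsUniformNoise P Ξ)
    {A : ℕ → Matrix (Fin 2) (Fin 2) ℝ} (hA : ∀ n, matOpNorm (A n) ≤ 1) {ε : ℝ} (hε : 0 < ε)
    (hε1 : ε ≤ 1) (n : ℕ) :
    (∫⁻ ω, sqrtDet (rowsOf (perturbedProd A (fun k => Ξ k ω) ε n))
        * (ENNReal.ofReal (matOpNorm (perturbedProd A (fun k => Ξ k ω) ε n)))⁻¹ ∂P) ^ 2
      ≤ ENNReal.ofReal (1 - ε ^ 2 / 10 ^ 8) ^ n := by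
  have h := projNormSq_lintegral_perturbedProd_le hΞ hA hε hε1 n negHomogeneous_invNorm
    measurable_invNorm
  have hPm := hΞ.measurable_rowsOf_perturbedProd A ε n
  have hnorm := measurable_matOpNorm_comp
    (measurable_perturbedProd_apply A ε n fun k _ => hΞ.measurable_entry k)
  set f : Ω → ℝ≥0∞ := fun ω => sqrtDet (rowsOf (perturbedProd A (fun k => Ξ k ω) ε n))
        * (ENNReal.ofReal (matOpNorm (perturbedProd A (fun k => Ξ k ω) ε n)))⁻¹ with hf
  have hfm : Measurable f := (measurable_sqrtDet.comp hPm).mul hnorm.ennreal_ofReal.inv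
  refine (ENNReal.mul_le_mul_iff_left projNormSq_invNorm_ne_zero projNormSq_invNorm_ne_top).1
    (le_trans ?_ h)
  have hm : Measurable fun t : ℝ => invNorm (t, 1) ^ 2 := by fun_prop
  rw [projNormSq, projNormSq, ← lintegral_const_mul _ hm]
  refine lintegral_mono fun t => ?_
  rw [← mul_pow]
  gcongr
  rw [← lintegral_mul_const _ hfm]
  exact lintegral_mono fun ω => sqrtDet_mul_inv_mul_invNorm_le _ _

/-- The random products have determinants with exponentially bounded negative moments, uniformly
over the centres `A n`. -/
theorem lintegral_inv_sqrtDet_perturbedProd_le [IsProbabilityMeasure P] (hΞ : IsUniformNoise P Ξ)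
    (A : ℕ → Matrix (Fin 2) (Fin 2) ℝ) {ε : ℝ} (hε : 0 < ε) (n : ℕ) :
    ∫⁻ ω, (sqrtDet (rowsOf (perturbedProd A (fun k => Ξ k ω) ε n)))⁻¹ ∂P
      ≤ ((ENNReal.ofReal (2 * ε) ^ 4)⁻¹ *
        ((invSqrtMass + ENNReal.ofReal (2 * ε)) ^ 2 * ENNReal.ofReal (2 * ε) ^ 2)) ^ n := by
  induction n with
  | zero => simp [perturbedProd, rowsOf, sqrtDet, rowDet]
  | succ n ih =>
    have hinv : ∀ M N : Matrix (Fin 2) (Fin 2) ℝ, (sqrtDet (rowsOf (M * N)))⁻¹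
        = (sqrtDet (rowsOf M))⁻¹ * (sqrtDet (rowsOf N))⁻¹ := fun M N => by
      rw [sqrtDet_rowsOf_mul,
        ENNReal.mul_inv (Or.inr (sqrtDet_ne_top _)) (Or.inl (sqrtDet_ne_top _))]
    simp only [perturbedProd, hinv]
    have hm := measurable_sqrtDet.inv
    rw [lintegral_noise_perturbedProd hΞ A hε n
      (Φ := fun z => (sqrtDet z.1)⁻¹ * (sqrtDet z.2)⁻¹) (by fun_prop)]
    simp only
    calc _ = ∫⁻ ω, (∫⁻ q, (sqrtDet q)⁻¹ ∂boxMeasure (rowsOf (A n)) ε)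
          * (sqrtDet (rowsOf (perturbedProd A (fun k => Ξ k ω) ε n)))⁻¹ ∂P :=
          lintegral_congr fun ω => lintegral_mul_const _ hm
      _ = (∫⁻ q, (sqrtDet q)⁻¹ ∂boxMeasure (rowsOf (A n)) ε)
          * ∫⁻ ω, (sqrtDet (rowsOf (perturbedProd A (fun k => Ξ k ω) ε n)))⁻¹ ∂P :=
          lintegral_const_mul _ (hm.comp (hΞ.measurable_rowsOf_perturbedProd A ε n))
      _ ≤ _ := by
          rw [pow_succ', boxMeasure, lintegral_smul_measure, smul_eq_mul]
          gcongr
          exact lintegral_rowBox_inv_sqrtDet_le _ hε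

/-- A Borel–Cantelli argument: variables with `E f_n ≤ x ^ n` are eventually below `y ^ n` for any
`y > x`. -/
theorem ae_eventually_le_pow {f : ℕ → Ω → ℝ≥0∞} (hf : ∀ n, Measurable (f n)) {x y : ℝ≥0∞}
    (hxy : x < y) (hy : y ≠ ∞) (h : ∀ n, ∫⁻ ω, f n ω ∂P ≤ x ^ n) :
    ∀ᵐ ω ∂P, ∀ᶠ n in atTop, f n ω ≤ y ^ n := by
  have hy0 : y ≠ 0 := (zero_le.trans_lt hxy).ne'
  have hP : ∀ n, P {ω | y ^ n ≤ f n ω} ≤ (x / y) ^ n := fun n => by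
    refine (meas_ge_le_lintegral_div (hf n).aemeasurable (pow_ne_zero n hy0)
      (ENNReal.pow_ne_top hy)).trans ?_
    rw [div_eq_mul_inv, div_eq_mul_inv, mul_pow, ENNReal.inv_pow]
    gcongr
    exact h n
  have hlt : x / y < 1 := (ENNReal.div_lt_iff (Or.inl hy0) (Or.inl hy)).2 (by simpa using hxy)
  have hsum : ∑' n, P {ω | y ^ n ≤ f n ω} ≠ ∞ := by
    refine ne_top_of_le_ne_top ?_ (ENNReal.tsum_le_tsum hP)
    rw [ENNReal.tsum_geometric]
    exact ENNReal.inv_ne_top.2 (tsub_pos_of_lt hlt).ne'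
  filter_upwards [ae_eventually_notMem hsum] with ω hω
  filter_upwards [hω] with n hn
  exact (not_le.1 hn).le

end

/-! ### The growth rate is a tail random variable -/

/-- The ratio `s₁ / s₂` of the singular values, written as `‖M‖² / |det M|`. -/
noncomputable def gapRatio (M : Matrix (Fin 2) (Fin 2) ℝ) : ℝ := matOpNorm M ^ 2 / |M.det|

theorem gapRate_eq (A Ξ : ℕ → Matrix (Fin 2) (Fin 2) ℝ) (ε : ℝ) :
    gapRate A Ξ ε = liminf (fun n : ℕ =>
      ((1 / (n : ℝ) * Real.log (gapRatio (perturbedProd A Ξ ε n)) : ℝ) : EReal)) atTop := by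
  simp only [gapRate, singVal_div_singVal, gapRatio]

theorem one_le_gapRatio {M : Matrix (Fin 2) (Fin 2) ℝ} (h : M.det ≠ 0) : 1 ≤ gapRatio M := by
  rw [gapRatio, one_le_div (abs_pos.2 h)]
  exact abs_det_le_sq_matOpNorm M

theorem gapRatio_mul_le (M N : Matrix (Fin 2) (Fin 2) ℝ) :
    gapRatio (M * N) ≤ gapRatio M * gapRatio N := by
  rw [gapRatio, gapRatio, gapRatio, div_mul_div_comm, Matrix.det_mul, abs_mul, ← mul_pow]
  gcongr
  · exact matOpNorm_nonneg _
  · exact matOpNorm_mul_le M N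

theorem log_gapRatio_mul_le {M N : Matrix (Fin 2) (Fin 2) ℝ} (hM : M.det ≠ 0) (hN : N.det ≠ 0) :
    Real.log (gapRatio (M * N)) ≤ Real.log (gapRatio M) + Real.log (gapRatio N) := by
  have h1 := one_le_gapRatio hM
  have h2 := one_le_gapRatio hN
  have h3 : 1 ≤ gapRatio (M * N) := one_le_gapRatio (by simp [Matrix.det_mul, hM, hN])
  rw [← Real.log_mul (by positivity) (by positivity)]
  exact Real.log_le_log (by linarith) (gapRatio_mul_le M N)

/-- Multiplication by a fixed invertible matrix changes the logarithm of the gap by a bounded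
amount. -/
theorem exists_abs_log_gapRatio_sub_le {N : Matrix (Fin 2) (Fin 2) ℝ} (hN : N.det ≠ 0) :
    ∃ C : ℝ, ∀ M : Matrix (Fin 2) (Fin 2) ℝ,
      |Real.log (gapRatio (M * N)) - Real.log (gapRatio M)| ≤ C := by
  have hunit : IsUnit N.det := isUnit_iff_ne_zero.2 hN
  have hN' : N⁻¹.det ≠ 0 := (Matrix.isUnit_nonsing_inv_det N hunit).ne_zero
  have l1 := Real.log_nonneg (one_le_gapRatio hN)
  have l2 := Real.log_nonneg (one_le_gapRatio hN')
  refine ⟨Real.log (gapRatio N) + Real.log (gapRatio N⁻¹), fun M => ?_⟩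
  rcases eq_or_ne M.det 0 with hM | hM
  · -- both ratios are `0` by the convention `x / 0 = 0`
    simp only [gapRatio, Matrix.det_mul, hM, zero_mul, abs_zero, div_zero, sub_self] at *
    linarith
  · have h1 := log_gapRatio_mul_le hM hN
    have h2 := log_gapRatio_mul_le (M := M * N) (by simp [Matrix.det_mul, hM, hN]) hN'
    rw [Matrix.mul_nonsing_inv_cancel_right _ _ hunit] at h2
    rw [abs_le]
    constructor <;> linarith

theorem liminf_coe_le_of_forall_eventually_le_add {u w : ℕ → ℝ}
    (h : ∀ η : ℝ, 0 < η → ∀ᶠ n in atTop, u n ≤ w n + η) :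
    liminf (fun n => (u n : EReal)) atTop ≤ liminf (fun n => (w n : EReal)) atTop := by
  refine le_of_forall_lt fun a ha => ?_
  obtain ⟨b, hab, hb⟩ := EReal.lt_iff_exists_real_btwn.1 ha
  obtain ⟨c, hbc, hc⟩ := EReal.lt_iff_exists_real_btwn.1 hb
  refine hab.trans_le (le_liminf_of_le (by isBoundedDefault) ?_)
  have hbc' : 0 < c - b := sub_pos.2 (EReal.coe_lt_coe_iff.1 hbc)
  filter_upwards [eventually_lt_of_lt_liminf hc, h _ hbc'] with n h1 h2
  have h3 := EReal.coe_lt_coe_iff.1 h1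
  exact EReal.coe_le_coe_iff.2 (by linarith)

/-- The random product in which the first `m` factors are replaced by the identity has the same
growth rate, provided that the replaced factors are invertible. -/
theorem gapRate_eq_of_det_ne_zero (A Ξ : ℕ → Matrix (Fin 2) (Fin 2) ℝ) (ε : ℝ) (m : ℕ)
    (hm : (perturbedProd A Ξ ε m).det ≠ 0) :
    gapRate (fun k => if k < m then 1 else A k) (fun k => if k < m then 0 else Ξ k) ε
      = gapRate A Ξ ε := by
  set A' : ℕ → Matrix (Fin 2) (Fin 2) ℝ := fun k => if k < m then 1 else A k with hA'
  set Ξ' : ℕ → Matrix (Fin 2) (Fin 2) ℝ := fun k => if k < m then 0 else Ξ k with hΞ'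
  have hone : ∀ n ≤ m, perturbedProd A' Ξ' ε n = 1 := fun n => by
    induction n with
    | zero => intro _; rfl
    | succ n ih =>
      intro hn
      have hlt : n < m := hn
      rw [perturbedProd, ih hlt.le]
      simp [hA', hΞ', hlt]
  have hfac : ∀ n, m ≤ n →
      perturbedProd A Ξ ε n = perturbedProd A' Ξ' ε n * perturbedProd A Ξ ε m := fun n hn => by
    induction n, hn using Nat.le_induction with
    | base => rw [hone m le_rfl, one_mul]
    | succ n hn ih =>
      have hlt : ¬ n < m := not_lt.2 hn
      simp only [perturbedProd, hA', hΞ', if_neg hlt, mul_assoc] at ih ⊢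
      rw [ih]
  obtain ⟨C, hC⟩ := exists_abs_log_gapRatio_sub_le hm
  have hC0 : 0 ≤ C := (abs_nonneg _).trans (hC 1)
  have hsmall : ∀ η : ℝ, 0 < η → ∀ᶠ n : ℕ in atTop,
      |1 / (n : ℝ) * Real.log (gapRatio (perturbedProd A Ξ ε n))
        - 1 / (n : ℝ) * Real.log (gapRatio (perturbedProd A' Ξ' ε n))| ≤ η := fun η hη => by
    have ht : Tendsto (fun n : ℕ => C / (n : ℝ)) atTop (𝓝 0) :=
      tendsto_const_div_atTop_nhds_zero_nat C
    filter_upwards [ht.eventually_le_const hη, eventually_ge_atTop m] with n h1 h2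
    rw [← mul_sub, abs_mul, abs_of_nonneg (by positivity), hfac n h2]
    calc 1 / (n : ℝ) * _ ≤ 1 / (n : ℝ) * C := by gcongr; exact hC _
      _ = C / n := by ring
      _ ≤ η := h1
  rw [gapRate_eq, gapRate_eq]
  refine le_antisymm (liminf_coe_le_of_forall_eventually_le_add fun η hη => ?_)
    (liminf_coe_le_of_forall_eventually_le_add fun η hη => ?_)
  all_goals
    filter_upwards [hsmall η hη] with n hn
    rw [abs_le] at hn
    linarith

theorem measurable_gapRate {Ω : Type*} [MeasurableSpace Ω]
    {Ξ : ℕ → Ω → Matrix (Fin 2) (Fin 2) ℝ} (A : ℕ → Matrix (Fin 2) (Fin 2) ℝ) (ε : ℝ)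
    (h : ∀ k i j, Measurable fun ω => Ξ k ω i j) :
    Measurable fun ω => gapRate A (fun k => Ξ k ω) ε := by
  simp_rw [gapRate_eq]
  refine Measurable.liminf fun n => measurable_coe_real_ereal.comp ?_
  have hP := fun i j => measurable_perturbedProd_apply A ε n (fun k _ => h k) i j
  have hdet : Measurable fun ω => (perturbedProd A (fun k => Ξ k ω) ε n).det := by
    simp_rw [Matrix.det_fin_two]
    have := hP
    fun_prop
  have hnorm := measurable_matOpNorm_comp hP
  unfold gapRatio
  fun_prop

theorem IsUniformNoise.ae_det_perturbedProd_ne_zero {Ω : Type*} [MeasurableSpace Ω]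
    {P : Measure Ω} [IsProbabilityMeasure P] {Ξ : ℕ → Ω → Matrix (Fin 2) (Fin 2) ℝ}
    (hΞ : IsUniformNoise P Ξ) (A : ℕ → Matrix (Fin 2) (Fin 2) ℝ) {ε : ℝ} (hε : 0 < ε) :
    ∀ᵐ ω ∂P, ∀ n, (perturbedProd A (fun k => Ξ k ω) ε n).det ≠ 0 := by
  refine ae_all_iff.2 fun n => ?_
  have h0 : 0 < ENNReal.ofReal (2 * ε) := by positivity
  have hne : (ENNReal.ofReal (2 * ε) ^ 4)⁻¹ ≠ ∞ := ENNReal.inv_ne_top.2 (by positivity)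
  have hlt : ∫⁻ ω, (sqrtDet (rowsOf (perturbedProd A (fun k => Ξ k ω) ε n)))⁻¹ ∂P ≠ ∞ :=
    ne_top_of_le_ne_top (by have := invSqrtMass_lt_top.ne; finiteness)
      (lintegral_inv_sqrtDet_perturbedProd_le hΞ A hε n)
  filter_upwards [ae_lt_top (measurable_sqrtDet.inv.comp
    (hΞ.measurable_rowsOf_perturbedProd A ε n)) hlt] with ω hω h
  simp [sqrtDet, rowDet_rowsOf, h] at hω

/-- By Kolmogorov's zero-one law the growth rate is almost surely constant. -/
theorem IsUniformNoise.exists_gapRate_ae_eq_const {Ω : Type*} [MeasurableSpace Ω]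
    {P : Measure Ω} [IsProbabilityMeasure P] {Ξ : ℕ → Ω → Matrix (Fin 2) (Fin 2) ℝ}
    (hΞ : IsUniformNoise P Ξ) (A : ℕ → Matrix (Fin 2) (Fin 2) ℝ) {ε : ℝ} (hε : 0 < ε) :
    ∃ c : EReal, ∀ᵐ ω ∂P, gapRate A (fun k => Ξ k ω) ε = c := by
  set G : ℕ → Ω → EReal := fun m ω =>
    gapRate (fun k => if k < m then 1 else A k) (fun k => if k < m then 0 else Ξ k ω) ε with hG
  -- `limsup G` is an exactly tail-measurable version of the growth rate
  have hGm : ∀ m₀ m, m₀ ≤ m → Measurable[noiseAlgebra Ξ {p | m₀ ≤ p.1}] (G m) := fun m₀ m hm => by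
    refine @measurable_gapRate _ (noiseAlgebra Ξ {p | m₀ ≤ p.1})
      (fun k ω => if k < m then 0 else Ξ k ω) _ ε fun k i j => ?_
    by_cases hk : k < m
    · simp only [if_pos hk]
      exact @measurable_const _ _ _ (noiseAlgebra Ξ {p | m₀ ≤ p.1}) _
    · simp only [if_neg hk]
      exact measurable_noiseAlgebra (hm.trans (not_lt.1 hk))
  have hlim : ∀ m₀, Measurable[noiseAlgebra Ξ {p | m₀ ≤ p.1}]
      fun ω => limsup (fun m => G m ω) atTop := fun m₀ => by
    have h : (fun ω => limsup (fun m => G m ω) atTop)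
        = fun ω => limsup (fun m => G (m + m₀) ω) atTop := by
      funext ω
      exact (limsup_nat_add (fun m => G m ω) m₀).symm
    rw [h]
    have hlimsup : ∀ (m' : MeasurableSpace Ω) (f : ℕ → Ω → EReal), (∀ n, Measurable[m'] (f n)) →
        Measurable[m'] fun ω => limsup (fun n => f n ω) atTop := fun _ _ hf => Measurable.limsup hf
    exact hlimsup _ _ fun m => hGm m₀ _ (Nat.le_add_left _ _)
  have hle : ∀ p : ℕ × Fin 2 × Fin 2,
      MeasurableSpace.comap (fun ω => Ξ p.1 ω p.2.1 p.2.2) inferInstance ≤ ‹MeasurableSpace Ω› :=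
    fun p => (hΞ.measurable_entry p.1 p.2.1 p.2.2).comap_le
  have h01 : ∀ U : Set EReal, MeasurableSet U →
      P ((fun ω => limsup (fun m => G m ω) atTop) ⁻¹' U) = 0 ∨
        P ((fun ω => limsup (fun m => G m ω) atTop) ⁻¹' U) = 1 := fun U hU => by
    refine measure_zero_or_one_of_measurableSet_limsup (ι := ℕ × Fin 2 × Fin 2)
      (s := fun p => MeasurableSpace.comap (fun ω => Ξ p.1 ω p.2.1 p.2.2) inferInstance)
      (f := comap Prod.fst atTop) (p := fun t => ∃ m, t ⊆ {p | p.1 < m})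
      (ns := fun m : ℕ => {p | p.1 < m}) hle hΞ.indep_entries.iIndep ?_ ?_ ?_ ?_ ?_
    · rintro t ⟨m, hm⟩
      refine mem_of_superset (preimage_mem_comap (Ici_mem_atTop m)) fun p hp hpt => ?_
      exact not_lt.2 (show m ≤ p.1 from hp) (hm hpt)
    · exact directed_of_isDirected_le fun m n hmn p hp => lt_of_lt_of_le hp hmn
    · exact fun m => ⟨m, subset_rfl⟩
    · exact fun p => ⟨p.1 + 1, Nat.lt_succ_self _⟩
    · rw [limsup_eq_iInf_iSup, MeasurableSpace.measurableSet_iInf]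
      intro S
      rw [MeasurableSpace.measurableSet_iInf]
      intro hS
      obtain ⟨T, hT, hTS⟩ := mem_comap.1 hS
      obtain ⟨m₀, hm₀⟩ := mem_atTop_sets.1 hT
      exact noiseAlgebra_mono (Ξ := Ξ) (fun p hp => hTS (hm₀ p.1 hp)) _ (hlim m₀ hU)
  obtain ⟨c, hc⟩ := exists_eventuallyEq_const_of_forall_separating (l := ae P)
    (f := fun ω => limsup (fun m => G m ω) atTop) MeasurableSet fun U hU => by
      have hmeas : MeasurableSet ((fun ω => limsup (fun m => G m ω) atTop) ⁻¹' U) :=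
        (iSup₂_le fun p _ => hle p : noiseAlgebra Ξ {p | 0 ≤ p.1} ≤ _) _ (hlim 0 hU)
      rcases h01 U hU with h | h
      · exact Or.inr (measure_eq_zero_iff_ae_notMem.1 h)
      · exact Or.inl ((mem_ae_iff_prob_eq_one hmeas).2 h)
  refine ⟨c, ?_⟩
  filter_upwards [hc, hΞ.ae_det_perturbedProd_ne_zero A hε] with ω h1 h2
  have h3 : ∀ m, G m ω = gapRate A (fun k => Ξ k ω) ε := fun m =>
    gapRate_eq_of_det_ne_zero A (fun k => Ξ k ω) ε m (h2 m)
  simpa [h3] using h1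

/-! ### Bounds for the growth rate -/

theorem exists_matOpNorm_add_smul_le :
    ∃ B : ℝ, 1 ≤ B ∧ ∀ A X : Matrix (Fin 2) (Fin 2) ℝ, ∀ ε : ℝ, 0 ≤ ε → ε ≤ 1 → matOpNorm A ≤ 1 →
      (∀ i j, X i j ∈ Set.Icc (-1 : ℝ) 1) → matOpNorm (A + ε • X) ≤ B := by
  have hK : IsCompact (Set.pi Set.univ fun _ : Fin 2 => Set.pi Set.univ fun _ : Fin 2 =>
      Set.Icc (-1 : ℝ) 1) :=
    isCompact_univ_pi fun _ => isCompact_univ_pi fun _ => isCompact_Icc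
  have hc : Continuous fun f : Fin 2 → Fin 2 → ℝ => matOpNorm (Matrix.of f) :=
    continuous_matOpNorm
  obtain ⟨B, hB⟩ := hK.bddAbove_image hc.continuousOn
  have hB0 : 0 ≤ B := (matOpNorm_nonneg _).trans
    (hB ⟨0, fun i _ j _ => by simp, rfl⟩)
  refine ⟨1 + B, by linarith, fun A X ε hε hε1 hA hX => ?_⟩
  have h1 : matOpNorm (ε • X) ≤ B := hB ⟨fun i j => ε * X i j, fun i _ j _ => by
    obtain ⟨h2, h3⟩ := hX i j
    constructor <;> nlinarith, rfl⟩
  exact (matOpNorm_add_le _ _).trans (add_le_add hA h1)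

theorem matOpNorm_perturbedProd_le {A Ξ : ℕ → Matrix (Fin 2) (Fin 2) ℝ} {ε B : ℝ}
    (h : ∀ n, matOpNorm (A n + ε • Ξ n) ≤ B) (n : ℕ) :
    matOpNorm (perturbedProd A Ξ ε n) ≤ B ^ n := by
  induction n with
  | zero => exact matOpNorm_one_le
  | succ n ih =>
    rw [pow_succ']
    exact (matOpNorm_mul_le _ _).trans
      (mul_le_mul (h n) ih (matOpNorm_nonneg _) ((matOpNorm_nonneg _).trans (h n)))

theorem IsUniformNoise.ae_mem_Icc {Ω : Type*} [MeasurableSpace Ω] {P : Measure Ω}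
    {Ξ : ℕ → Ω → Matrix (Fin 2) (Fin 2) ℝ} (hΞ : IsUniformNoise P Ξ) :
    ∀ᵐ ω ∂P, ∀ n i j, Ξ n ω i j ∈ Set.Icc (-1 : ℝ) 1 := by
  refine ae_all_iff.2 fun n => ae_all_iff.2 fun i => ae_all_iff.2 fun j => ?_
  refine ae_of_ae_map (hΞ.measurable_entry n i j).aemeasurable
    (p := fun x => x ∈ Set.Icc (-1 : ℝ) 1) ?_
  rw [hΞ.uniform_entry n i j]
  exact ae_cond_mem measurableSet_Icc

/-- The growth rate is at least `2 log (1 / (1 - κ / 4)) ≥ κ / 2`, where `1 - κ` is the contraction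
factor of the squared norms. -/
theorem IsUniformNoise.ae_le_gapRate {Ω : Type*} [MeasurableSpace Ω]
    {P : Measure Ω} [IsProbabilityMeasure P] {Ξ : ℕ → Ω → Matrix (Fin 2) (Fin 2) ℝ}
    (hΞ : IsUniformNoise P Ξ) {A : ℕ → Matrix (Fin 2) (Fin 2) ℝ} (hA : ∀ n, matOpNorm (A n) ≤ 1)
    {ε : ℝ} (hε : 0 < ε) (hε1 : ε ≤ 1) :
    ∀ᵐ ω ∂P, ((ε ^ 2 / (2 * 10 ^ 8) : ℝ) : EReal) ≤ gapRate A (fun k => Ξ k ω) ε := by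
  set κ : ℝ := ε ^ 2 / 10 ^ 8 with hκ
  have hκ0 : 0 < κ := by positivity
  have hκ1 : κ ≤ 1 / 2 := by rw [hκ]; nlinarith
  have hmom : ∀ n, ∫⁻ ω, sqrtDet (rowsOf (perturbedProd A (fun k => Ξ k ω) ε n))
      * (ENNReal.ofReal (matOpNorm (perturbedProd A (fun k => Ξ k ω) ε n)))⁻¹ ∂P
      ≤ ENNReal.ofReal (1 - κ / 2) ^ n := fun n => by
    refine (ENNReal.pow_le_pow_left_iff two_ne_zero).1
      ((sq_lintegral_sqrtDet_div_matOpNorm_le hΞ hA hε hε1 n).trans ?_)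
    rw [← pow_mul, mul_comm n, pow_mul]
    refine pow_le_pow_left' ?_ n
    rw [← ENNReal.ofReal_pow (by linarith)]
    exact ENNReal.ofReal_le_ofReal (by nlinarith [sq_nonneg κ])
  have hmeas : ∀ n, Measurable fun ω =>
      sqrtDet (rowsOf (perturbedProd A (fun k => Ξ k ω) ε n))
        * (ENNReal.ofReal (matOpNorm (perturbedProd A (fun k => Ξ k ω) ε n)))⁻¹ := fun n =>
    (measurable_sqrtDet.comp (hΞ.measurable_rowsOf_perturbedProd A ε n)).mul
      (measurable_matOpNorm_comp
        (measurable_perturbedProd_apply A ε n fun k _ => hΞ.measurable_entry k)).ennreal_ofReal.inv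
  have hbc := ae_eventually_le_pow hmeas (y := ENNReal.ofReal (1 - κ / 4))
    ((ENNReal.ofReal_lt_ofReal_iff (by linarith)).2 (by linarith)) ENNReal.ofReal_ne_top hmom
  filter_upwards [hbc, hΞ.ae_det_perturbedProd_ne_zero A hε] with ω hω hdet
  rw [gapRate_eq]
  refine le_liminf_of_le (by isBoundedDefault) ?_
  filter_upwards [hω, eventually_gt_atTop 0] with n hn hn0
  rw [EReal.coe_le_coe_iff]
  set M := perturbedProd A (fun k => Ξ k ω) ε n
  have hq : 0 < 1 - κ / 4 := by linarith
  have hd : 0 < |M.det| := abs_pos.2 (hdet n)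
  have hM : 0 < matOpNorm M := by
    have h := abs_det_le_sq_matOpNorm M
    exact (matOpNorm_nonneg M).lt_of_ne fun h0 => by rw [← h0] at h; norm_num at h; exact hdet n h
  have h1 : √|M.det| / matOpNorm M ≤ (1 - κ / 4) ^ n := by
    rw [sqrtDet, rowDet_rowsOf, ← div_eq_mul_inv, ← ENNReal.ofReal_div_of_pos hM,
      ← ENNReal.ofReal_pow hq.le] at hn
    exact (ENNReal.ofReal_le_ofReal_iff (by positivity)).1 hn
  have h2 : gapRatio M = ((√|M.det| / matOpNorm M) ^ 2)⁻¹ := by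
    rw [gapRatio, div_pow, Real.sq_sqrt hd.le, inv_div]
  have h3 : Real.log (√|M.det| / matOpNorm M) ≤ n * (-(κ / 4)) := by
    calc Real.log (√|M.det| / matOpNorm M) ≤ Real.log ((1 - κ / 4) ^ n) :=
          Real.log_le_log (by positivity) h1
      _ = n * Real.log (1 - κ / 4) := Real.log_pow _ _
      _ ≤ n * (-(κ / 4)) := by
          gcongr
          linarith [Real.log_le_sub_one_of_pos hq]
  have hn' : (0 : ℝ) < n := Nat.cast_pos.2 hn0
  rw [h2, Real.log_inv, Real.log_pow, one_div, ← div_eq_inv_mul, le_div_iff₀ hn']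
  push_cast
  rw [show ε ^ 2 / (2 * 10 ^ 8) = κ / 2 by rw [hκ]; ring]
  linarith

/-- The growth rate is finite, because the negative moments of the determinants are bounded. -/
theorem IsUniformNoise.exists_ae_gapRate_le {Ω : Type*} [MeasurableSpace Ω]
    {P : Measure Ω} [IsProbabilityMeasure P] {Ξ : ℕ → Ω → Matrix (Fin 2) (Fin 2) ℝ}
    (hΞ : IsUniformNoise P Ξ) {A : ℕ → Matrix (Fin 2) (Fin 2) ℝ} (hA : ∀ n, matOpNorm (A n) ≤ 1)
    {ε : ℝ} (hε : 0 < ε) (hε1 : ε ≤ 1) :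
    ∃ C : ℝ, ∀ᵐ ω ∂P, gapRate A (fun k => Ξ k ω) ε ≤ (C : EReal) := by
  obtain ⟨B, hB1, hB⟩ := exists_matOpNorm_add_smul_le
  have h0 : 0 < ENNReal.ofReal (2 * ε) := by positivity
  have hne : (ENNReal.ofReal (2 * ε) ^ 4)⁻¹ ≠ ∞ := ENNReal.inv_ne_top.2 (by positivity)
  set x : ℝ≥0∞ := (ENNReal.ofReal (2 * ε) ^ 4)⁻¹ *
    ((invSqrtMass + ENNReal.ofReal (2 * ε)) ^ 2 * ENNReal.ofReal (2 * ε) ^ 2) with hx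
  have hxt : x ≠ ∞ := by have := invSqrtMass_lt_top.ne; finiteness
  set y : ℝ := x.toReal + 1 with hy
  have hy0 : 0 < y := by positivity
  have hxy : x < ENNReal.ofReal y := by
    rw [← ENNReal.ofReal_toReal hxt]
    exact (ENNReal.ofReal_lt_ofReal_iff hy0).2 (lt_add_one _)
  have hbc := ae_eventually_le_pow
    (fun n => measurable_sqrtDet.inv.comp (hΞ.measurable_rowsOf_perturbedProd A ε n)) hxy
    ENNReal.ofReal_ne_top (lintegral_inv_sqrtDet_perturbedProd_le hΞ A hε)
  refine ⟨2 * (Real.log B + Real.log y), ?_⟩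
  filter_upwards [hbc, hΞ.ae_det_perturbedProd_ne_zero A hε, hΞ.ae_mem_Icc] with ω hω hdet hmem
  rw [gapRate_eq]
  refine (liminf_le_limsup (u := fun n : ℕ => ((1 / (n : ℝ) *
    Real.log (gapRatio (perturbedProd A (fun k => Ξ k ω) ε n)) : ℝ) : EReal))).trans (limsup_le_of_le (by isBoundedDefault) ?_)
  filter_upwards [hω, eventually_gt_atTop 0] with n hn hn0
  rw [EReal.coe_le_coe_iff]
  have hnorm : matOpNorm (perturbedProd A (fun k => Ξ k ω) ε n) ≤ B ^ n :=
    matOpNorm_perturbedProd_le (fun k => hB _ _ ε hε.le hε1 (hA k) (hmem k)) n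
  simp only [Function.comp_apply, Pi.inv_apply] at hn
  set M := perturbedProd A (fun k => Ξ k ω) ε n
  have hd : 0 < |M.det| := abs_pos.2 (hdet n)
  have h1 : (√|M.det|)⁻¹ ≤ y ^ n := by
    rw [sqrtDet, rowDet_rowsOf, ← ENNReal.ofReal_inv_of_pos (Real.sqrt_pos.2 hd),
      ← ENNReal.ofReal_pow hy0.le] at hn
    exact (ENNReal.ofReal_le_ofReal_iff (by positivity)).1 hn
  have h2 : gapRatio M = (matOpNorm M * (√|M.det|)⁻¹) ^ 2 := by
    rw [gapRatio, mul_pow, inv_pow, Real.sq_sqrt hd.le, div_eq_mul_inv]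
  have h3 : gapRatio M ≤ ((B * y) ^ n) ^ 2 := by
    rw [h2, mul_pow B]
    have := matOpNorm_nonneg M
    gcongr
  have h4 : Real.log (gapRatio M) ≤ 2 * (n * (Real.log B + Real.log y)) := by
    rw [← Real.log_mul (by positivity) hy0.ne', ← Real.log_pow, ← Nat.cast_ofNat (R := ℝ),
      ← Real.log_pow]
    exact Real.log_le_log (by linarith [one_le_gapRatio (hdet n)]) h3
  have hn' : (0 : ℝ) < n := Nat.cast_pos.2 hn0
  rw [one_div, ← div_eq_inv_mul, div_le_iff₀ hn']
  linarith

theorem exp_neg_inv_pow_lt {ε : ℝ} (hε : 0 < ε) (hε2 : ε < 1 / 2) :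
    Real.exp (-(1 / ε ^ 35)) < ε ^ 2 / (2 * 10 ^ 8) := by
  have h1 : ε ^ 33 < (1 / 2) ^ 33 := pow_lt_pow_left₀ hε2 hε.le (by norm_num)
  have h2 : 1 / ε ^ 35 < Real.exp (1 / ε ^ 35) := by
    linarith [Real.add_one_le_exp (1 / ε ^ 35)]
  rw [Real.exp_neg]
  calc (Real.exp (1 / ε ^ 35))⁻¹ < (1 / ε ^ 35)⁻¹ :=
        inv_strictAnti₀ (by positivity) h2
    _ = ε ^ 33 * ε ^ 2 := by rw [one_div, inv_inv, ← pow_add]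
    _ ≤ 1 / (2 * 10 ^ 8) * ε ^ 2 := by
        gcongr
        exact h1.le.trans (by norm_num)
    _ = _ := by ring

theorem theoremA :
    ∃ c₂ : ℝ → ℝ,
      (∀ ε : ℝ, 0 < ε → ε < 1 →
        0 < c₂ ε ∧
        ∀ (A : ℕ → Matrix (Fin 2) (Fin 2) ℝ), (∀ n, matOpNorm (A n) ≤ 1) →
        ∀ (Ω : Type*) [MeasurableSpace Ω] (P : Measure Ω) [IsProbabilityMeasure P]
          (Ξ : ℕ → Ω → Matrix (Fin 2) (Fin 2) ℝ), IsUniformNoise P Ξ →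
          ∃ c : ℝ, c₂ ε ≤ c ∧ ∀ᵐ ω ∂P, gapRate A (fun n => Ξ n ω) ε = (c : EReal)) ∧
      (∀ᶠ ε in 𝓝[>] (0 : ℝ), Real.exp (-(1 / ε ^ 35)) < c₂ ε) := by
  refine ⟨fun ε => ε ^ 2 / (2 * 10 ^ 8), fun ε hε hε1 => ⟨by positivity, ?_⟩, ?_⟩
  · intro A hA Ω _ P _ Ξ hΞ
    obtain ⟨c, hc⟩ := hΞ.exists_gapRate_ae_eq_const A hε
    obtain ⟨C, hC⟩ := hΞ.exists_ae_gapRate_le hA hε hε1.le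
    obtain ⟨ω, h1, h2, h3⟩ := (hc.and ((hΞ.ae_le_gapRate hA hε hε1.le).and hC)).exists
    rw [h1] at h2 h3
    lift c to ℝ using ⟨(h3.trans_lt (EReal.coe_lt_top C)).ne,
      ((EReal.bot_lt_coe _).trans_le h2).ne'⟩
    exact ⟨c, EReal.coe_le_coe_iff.1 h2, hc⟩
  · filter_upwards [Ioo_mem_nhdsGT (show (0 : ℝ) < 1 / 2 by norm_num)] with ε hε
    exact exp_neg_inv_pow_lt hε.1 hε.2
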